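/- **Theorem (Non-central limit).** Let $q\ge 2$ be an integer and let $\alpha,\beta\in\left(1-\frac1{2q},1\right)$. Let $W=(W_{s,t})_{(s,t)\in[0,1]^2}$ be a fractional Brownian sheet with Hurst indices $(\alpha,\beta)$ on a probability space $(\Omega,\mathcal F,P)$, that is, a centered Gaussian process, vanishing almost surely at each point $(s,t)$ with $s=0$ or $t=0$, with $$\mathbb E[W_{s,t}W_{s',t'}]=\tfrac12\left(s^{2\alpha}+s'^{2\alpha}-|s-s'|^{2\alpha}\right)\cdot\tfrac12\left(t^{2\beta}+t'^{2\beta}-|t-t'|^{2\beta}\right).$$ Let $\mathcal H$ be the closure of the linear span of the indicator functions $\mathbf 1_{[0,s]\times[0,t]}$ for the scalar product $\langle \mathbf 1_{[0,s]\times[0,t]},\mathbf 1_{[0,s']\times[0,t']}\rangle=\mathbb E[W_{s,t}W_{s',t'}]$, let $\varphi\mapsto W(\varphi)$ be the linear isometry $\mathcal H\to L^2(\Omega)$ that extends $\mathbf 1_{[0,s]\times[0,t]}\mapsto W_{s,t}$, let $\mathcal H^{\otimes q}$ be the Hilbert tensor power and let $\mathcal H^{\odot q}\subset\mathcal H^{\otimes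 q}$ be its closed subspace of symmetric tensors, generated by the tensors $\varphi^{\otimes q}$. Let $H_q(x)=\frac{(-1)^q}{q!}e^{x^2/2}\frac{d^q}{dx^q}e^{-x^2/2}$ and, for $\gamma\in\{\alpha,\beta\}$, $$\kappa_\gamma=\frac{\gamma^q(2\gamma-1)^q}{(\gamma q-q+1)(2\gamma q-2q+1)},\qquad \phi_{N,M}=\sqrt{\frac{q!}{\kappa_\alpha\kappa_\beta}}\,N^{q-1}M^{q-1}.$$ Write $\Delta_{i,j}=[\frac iN,\frac{i+1}N]\times[\frac jM,\frac{j+1}M]$, where $\mathbf 1_{\Delta_{i,j}}\in\mathcal H$ is the corresponding combination of the indicators of $[0,s]\times[0,t]$ at the four corners $(s,t)$ of $\Delta_{i,j}$. Then: 1. There is exactly one continuous linear map $I_q:\mathcal H^{\odot q}\to L^2(\Omega)$ with $I_q(\varphi^{\otimes q})=q!\,H_q(W(\varphi))$ for all $\varphi\in\mathcal H$ with $\|\varphi\|=1$ and $\mathbb E[I_q(f)^2]=q!\,\|f\|^2$ for all $f$. 2. For all $s,t\in[0,1]$ the kernels $$h_{N,M}(t,s)=\frac1{q!}\,\phi_{N,M}\sum_{i=0}^{\lfloor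 (N-1)t\rfloor}\ \sum_{j=0}^{\lfloor (M-1)s\rfloor}\mathbf 1_{\Delta_{i,j}}^{\otimes q}$$ converge in $\mathcal H^{\otimes q}$ as $N,M\to\infty$ to a limit $\mu^{(q)}_{t,s}\in\mathcal H^{\odot q}$. The Hermite sheet is defined by $Z^{(q)}_{t,s}=I_q(\mu^{(q)}_{t,s})$. 3. The renormalized Hermite variations $$\tilde V_{N,M}=\frac1{q!}\,\phi_{N,M}\sum_{i=0}^{N-1}\sum_{j=0}^{M-1}I_q\left(\mathbf 1_{\Delta_{i,j}}^{\otimes q}\right)$$ satisfy, almost surely for all $N,M\ge1$, $\tilde V_{N,M}=\phi_{N,M}N^{-\alpha q}M^{-\beta q}V_{N,M}$ with $$V_{N,M}=\sum_{i=0}^{N-1}\sum_{j=0}^{M-1}H_q\left(N^\alpha M^\beta\left(W_{\frac{i+1}N,\frac{j+1}M}-W_{\frac iN,\frac{j+1}M}-W_{\frac{i+1}N,\frac jM}+W_{\frac iN,\frac jM}\right)\right).$$ 4. With $Z=Z^{(q)}_{1,1}$, $$\lim_{N,M\to\infty}\mathbb E\left[|\tilde V_{N,M}-Z|^2\right]=0.$$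 -/

import Mathlib

open MeasureTheory ProbabilityTheory Filter Topology
open scoped unitInterval ENNReal RealInnerProductSpace TensorProduct

noncomputable section

namespace HermiteVariations

/-! ### The fractional Brownian sheet -/

/-- Covariance of the fractional Brownian motion with Hurst index `γ`. -/
def fbmCov (γ s t : ℝ) : ℝ := (s ^ (2 * γ) + t ^ (2 * γ) - |s - t| ^ (2 * γ)) / 2

/-- Covariance of the fractional Brownian sheet with Hurst indices `(α, β)` on `[0,1]²`. -/
def sheetCov (α β : ℝ) (p r : I × I) : ℝ := fbmCov α p.1 r.1 * fbmCov β p.2 r.2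

/-- `W` is a fractional Brownian sheet on `[0,1]²` with Hurst indices `(α, β)`: a centered Gaussian
process with covariance `sheetCov α β` that vanishes on the axes. -/
structure IsFractionalBrownianSheet {Ω : Type*} [MeasurableSpace Ω] (α β : ℝ)
    (W : I × I → Ω → ℝ) (P : Measure Ω) : Prop where
  gaussian : IsGaussianProcess W P
  centered : ∀ p, ∫ ω, W p ω ∂P = 0
  axes : ∀ p : I × I, p.1 = 0 ∨ p.2 = 0 → ∀ᵐ ω ∂P, W p ω = 0
  covariance : ∀ p r, ∫ ω, W p ω * W r ω ∂P = sheetCov α β p r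

/-! ### The canonical Hilbert space of the sheet

A finitely supported `f : I × I →₀ ℝ` stands for the step function `∑ f(s,t) 𝟏_{[0,s]×[0,t]}`
on `[0,1]²`. As `stepFunction_injective` shows, this identifies `I × I →₀ ℝ` with the linear span
of the indicator functions. -/

/-- The step function `∑ f(s,t) 𝟏_{[0,s]×[0,t]}` coded by `f`. In the order of `[0,1]²`, the
rectangle `[0,s] × [0,t]` is `Set.Iic (s, t)`. -/
def stepFunction : (I × I →₀ ℝ) →ₗ[ℝ] (I × I → ℝ) :=
  Finsupp.linearCombination ℝ fun p : I × I => (Set.Iic p).indicator (1 : I × I → ℝ)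

theorem stepFunction_injective : Function.Injective stepFunction := by
  classical
  rw [injective_iff_map_eq_zero]
  intro f hf
  by_contra hne
  obtain ⟨p, hp⟩ := f.support.exists_maximal (Finsupp.support_nonempty_iff.2 hne)
  have h := congrFun hf p
  rw [stepFunction, Finsupp.linearCombination_apply, Finsupp.sum, Finset.sum_apply,
    Finset.sum_eq_single p] at h
  · exact (Finsupp.mem_support_iff.1 hp.prop) (by simpa using h)
  · intro r hr hrp
    have : ¬ p ≤ r := fun hpr => hrp (le_antisymm (hp.le_of_ge hr hpr) hpr)
    simp [Set.indicator, this]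
  · intro hn
    exact absurd hp.prop hn

section Canonical

variable {Ω : Type*} [MeasurableSpace Ω] {α β : ℝ} {W : I × I → Ω → ℝ} {P : Measure Ω}

theorem IsFractionalBrownianSheet.memLp (hW : IsFractionalBrownianSheet α β W P) (p : I × I) :
    MemLp (W p) 2 P :=
  (hW.gaussian.hasGaussianLaw_eval p).memLp (by simp)

/-- Linear combinations of indicators, with the scalar product determined by
`⟨𝟏_{[0,s]×[0,t]}, 𝟏_{[0,s']×[0,t']}⟩ = sheetCov α β (s,t) (s',t')`. -/
def StepSpace (_ : IsFractionalBrownianSheet α β W P) : Type := I × I →₀ ℝ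

namespace StepSpace

variable (hW : IsFractionalBrownianSheet α β W P)

instance : AddCommGroup (StepSpace hW) := inferInstanceAs (AddCommGroup (I × I →₀ ℝ))

instance : Module ℝ (StepSpace hW) := inferInstanceAs (Module ℝ (I × I →₀ ℝ))

/-- The element of `StepSpace hW` coded by a finitely supported function. -/
def of : (I × I →₀ ℝ) ≃ₗ[ℝ] StepSpace hW := LinearEquiv.refl ℝ (I × I →₀ ℝ)

/-- The integral of step functions with respect to the sheet: `𝟏_{[0,s]×[0,t]} ↦ W_{s,t}`. -/
def integral : StepSpace hW →ₗ[ℝ] Lp ℝ 2 P :=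
  (Finsupp.linearCombination ℝ fun p : I × I => (hW.memLp p).toLp (W p)) ∘ₗ (of hW).symm

/-- The scalar product of two step functions. -/
def form (f g : StepSpace hW) : ℝ :=
  ((of hW).symm f).sum fun p a => ((of hW).symm g).sum fun r b => a * b * sheetCov α β p r

theorem inner_integral (f g : StepSpace hW) :
    ⟪integral hW f, integral hW g⟫ = form hW f g := by
  have key : ∀ p r : I × I,
      ⟪(hW.memLp p).toLp (W p), (hW.memLp r).toLp (W r)⟫ = sheetCov α β p r := by
    intro p r
    rw [← hW.covariance p r, L2.inner_def]
    refine integral_congr_ae ?_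
    filter_upwards [(hW.memLp p).coeFn_toLp, (hW.memLp r).coeFn_toLp] with ω h1 h2
    rw [h1, h2]
    simp [mul_comm]
  simp only [integral, form, LinearMap.comp_apply, LinearEquiv.coe_coe,
    Finsupp.linearCombination_apply, Finsupp.sum, sum_inner, inner_sum, inner_smul_right,
    inner_smul_left, key]
  simp only [Finset.mul_sum]
  rw [Finset.sum_comm]
  refine Finset.sum_congr rfl fun p _ => Finset.sum_congr rfl fun r _ => ?_
  simp [mul_left_comm, mul_assoc]

/-- Positivity is inherited from the covariance of the sheet. -/
instance : PreInnerProductSpace.Core ℝ (StepSpace hW) where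
  inner f g := form hW f g
  conj_inner_symm f g := by
    simp only [← inner_integral hW]
    exact real_inner_comm (StepSpace.integral hW f) (StepSpace.integral hW g)
  re_inner_nonneg f := by
    simp only [← inner_integral hW]
    exact real_inner_self_nonneg (x := StepSpace.integral hW f)
  add_left f g k := by
    simp only [← inner_integral hW, map_add, inner_add_left]
  smul_left f g r := by
    simp only [← inner_integral hW, map_smul, inner_smul_left]

instance : SeminormedAddCommGroup (StepSpace hW) :=
  InnerProductSpace.Core.toSeminormedAddCommGroup (𝕜 := ℝ)

instance : InnerProductSpace ℝ (StepSpace hW) := .ofCore _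

/-- `StepSpace.integral` is an isometry. -/
def integralIsometry : StepSpace hW →ₗᵢ[ℝ] Lp ℝ 2 P :=
  (integral hW).isometryOfInner (inner_integral hW)

end StepSpace

variable (hW : IsFractionalBrownianSheet α β W P)

/-- The canonical Hilbert space of the sheet: the closure of the linear span of the indicator
functions of `[0,s] × [0,t]` for the scalar product given by the covariance. -/
abbrev CanonicalSpace : Type := UniformSpace.Completion (StepSpace hW)

/-- The image `W(φ)` of `φ` under the isometry from the canonical space to the first chaos
that extends `𝟏_{[0,s]×[0,t]} ↦ W_{s,t}`. -/
def wiener : CanonicalSpace hW →L[ℝ] Lp ℝ 2 P :=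
  (StepSpace.integralIsometry hW).toContinuousLinearMap.extend UniformSpace.Completion.toComplL

/-- Formal step function of the rectangle with corners `(s, t)` and `(s', t')`. -/
def rectStep (s s' t t' : I) : I × I →₀ ℝ :=
  .single (s', t') 1 - .single (s, t') 1 - .single (s', t) 1 + .single (s, t) 1

theorem stepFunction_rectStep {s s' t t' : I} (hs : s ≤ s') (ht : t ≤ t') :
    stepFunction (rectStep s s' t t') =
      (Set.Ioc s s' ×ˢ Set.Ioc t t').indicator (1 : I × I → ℝ) := by
  classical
  funext ⟨u, v⟩
  simp only [stepFunction, rectStep, map_add, map_sub, Finsupp.linearCombination_single, one_smul,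
    Pi.add_apply, Pi.sub_apply, Set.indicator, Set.mem_Iic, Prod.mk_le_mk, Set.mem_prod,
    Set.mem_Ioc, Pi.one_apply]
  by_cases h1 : u ≤ s <;> by_cases h2 : u ≤ s' <;> by_cases h3 : v ≤ t <;> by_cases h4 : v ≤ t' <;>
    simp [h1, h2, h3, h4, not_le.1, ← not_le] <;>
    first
      | exact absurd (h1.trans hs) h2
      | exact absurd (h3.trans ht) h4

/-- The point `i / N` of `[0,1]` (for `i ≤ N`). -/
def gridPoint (N i : ℕ) : I := Set.projIcc (0 : ℝ) 1 zero_le_one ((i : ℝ) / N)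

/-- The indicator function of `[i/N, (i+1)/N] × [j/M, (j+1)/M]`, as an element of the canonical
Hilbert space. -/
def cell (N M i j : ℕ) : CanonicalSpace hW :=
  ((StepSpace.of hW (rectStep (gridPoint N i) (gridPoint N (i + 1))
    (gridPoint M j) (gridPoint M (j + 1))) : StepSpace hW) : CanonicalSpace hW)

end Canonical

/-! ### Hilbert tensor powers -/

section Tensor

variable (H : Type*) [NormedAddCommGroup H] [InnerProductSpace ℝ H] (n : ℕ)

/-- The algebraic tensor power of `H`, to be equipped with the scalar product determined by
`⟨f₁ ⊗ ⋯ ⊗ fₙ, g₁ ⊗ ⋯ ⊗ gₙ⟩ = ∏ ⟨fᵢ, gᵢ⟩`. -/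
def AlgTensorPower : Type _ := ⨂[ℝ] _ : Fin n, H

namespace AlgTensorPower

instance : AddCommGroup (AlgTensorPower H n) := inferInstanceAs (AddCommGroup (⨂[ℝ] _ : Fin n, H))

instance : Module ℝ (AlgTensorPower H n) := inferInstanceAs (Module ℝ (⨂[ℝ] _ : Fin n, H))

/-- The identification with the algebraic tensor power. -/
def of : (⨂[ℝ] _ : Fin n, H) ≃ₗ[ℝ] AlgTensorPower H n := LinearEquiv.refl ℝ (⨂[ℝ] _ : Fin n, H)

variable {H n}

/-- The elementary tensor `f₁ ⊗ ⋯ ⊗ fₙ`. -/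
def pure (f : Fin n → H) : AlgTensorPower H n := of H n (PiTensorProduct.tprod ℝ f)

variable (H n) in
/-- The bilinear form `⟨⊗ fᵢ, ⊗ gᵢ⟩ = ∏ ⟨fᵢ, gᵢ⟩`. -/
def form : AlgTensorPower H n →ₗ[ℝ] AlgTensorPower H n →ₗ[ℝ] ℝ :=
  ((PiTensorProduct.dualDistrib (R := ℝ) (M := fun _ : Fin n => H)) ∘ₗ
    (PiTensorProduct.map fun _ : Fin n => innerₗ H)).compl₁₂
      (of H n).symm.toLinearMap (of H n).symm.toLinearMap

theorem form_pure (f g : Fin n → H) : form H n (pure f) (pure g) = ∏ i, ⟪f i, g i⟫ := by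
  simp [form, pure, PiTensorProduct.map_tprod, PiTensorProduct.dualDistrib_apply]

theorem exists_eq_sum (x : AlgTensorPower H n) :
    ∃ c : (Fin n → H) →₀ ℝ, c.sum (fun f a => a • pure f) = x := by
  have hx : (of H n).symm x ∈
      Submodule.span ℝ (Set.range (PiTensorProduct.tprod ℝ : _ → ⨂[ℝ] _ : Fin n, H)) := by
    rw [PiTensorProduct.span_tprod_eq_top]; trivial
  obtain ⟨c, hc⟩ := (Finsupp.mem_span_range_iff_exists_finsupp).1 hx
  refine ⟨c, (of H n).symm.injective ?_⟩
  rw [← hc]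
  simp [Finsupp.sum, pure]

theorem form_sum (c d : (Fin n → H) →₀ ℝ) :
    form H n (c.sum fun f a => a • pure f) (d.sum fun f a => a • pure f) =
      c.sum fun f a => d.sum fun g b => a * (b * ∏ i, ⟪f i, g i⟫) := by
  simp only [Finsupp.sum, map_sum, LinearMap.sum_apply, map_smul, LinearMap.smul_apply, form_pure,
    smul_eq_mul, Finset.mul_sum]
  rw [Finset.sum_comm]
  simp only [mul_left_comm]

theorem form_symm (x y : AlgTensorPower H n) : form H n x y = form H n y x := by
  obtain ⟨c, rfl⟩ := exists_eq_sum x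
  obtain ⟨d, rfl⟩ := exists_eq_sum y
  rw [form_sum, form_sum, Finsupp.sum_comm]
  simp only [real_inner_comm, mul_left_comm]

theorem posSemidef_inner {X E : Type*} [NormedAddCommGroup E] [InnerProductSpace ℝ E] (v : X → E) :
    (Matrix.of fun x y => ⟪v x, v y⟫).PosSemidef := by
  refine ⟨Matrix.ext fun x y => by simp [real_inner_comm], fun c => ?_⟩
  have h : 0 ≤ ⟪∑ x ∈ c.support, c x • v x, ∑ y ∈ c.support, c y • v y⟫ := real_inner_self_nonneg
  simp only [sum_inner, inner_sum, inner_smul_left, inner_smul_right,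
    Finset.mul_sum] at h
  rw [Finset.sum_comm] at h
  simpa [Finsupp.sum, mul_comm, mul_left_comm, mul_assoc, Finset.mul_sum] using h

theorem posSemidef_prod (s : Finset (Fin n)) :
    (Matrix.of fun f g : Fin n → H => ∏ i ∈ s, ⟪f i, g i⟫).PosSemidef := by
  classical
  induction s using Finset.induction_on with
  | empty => simpa using posSemidef_inner (fun _ : Fin n → H => (1 : ℝ))
  | insert i s hi ih =>
    have h := (posSemidef_inner (fun f : Fin n → H => f i)).hadamard ih
    have e : (Matrix.of fun f g : Fin n → H => ∏ j ∈ insert i s, ⟪f j, g j⟫) =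
        Matrix.hadamard (Matrix.of fun f g : Fin n → H => ⟪f i, g i⟫)
          (Matrix.of fun f g : Fin n → H => ∏ j ∈ s, ⟪f j, g j⟫) := by
      ext f g
      simp [Finset.prod_insert hi]
    rw [e]
    exact h

theorem form_nonneg (x : AlgTensorPower H n) : 0 ≤ form H n x x := by
  obtain ⟨c, rfl⟩ := exists_eq_sum x
  rw [form_sum]
  have h := (posSemidef_prod (H := H) (Finset.univ : Finset (Fin n))).2 c
  simpa [mul_comm, mul_left_comm, mul_assoc] using h

instance : PreInnerProductSpace.Core ℝ (AlgTensorPower H n) where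
  inner x y := form H n x y
  conj_inner_symm x y := form_symm y x
  re_inner_nonneg x := form_nonneg x
  add_left x y z := by simp
  smul_left x y r := by simp

instance : SeminormedAddCommGroup (AlgTensorPower H n) :=
  InnerProductSpace.Core.toSeminormedAddCommGroup (𝕜 := ℝ)

instance : InnerProductSpace ℝ (AlgTensorPower H n) := .ofCore _

end AlgTensorPower

/-- The Hilbert tensor power `H^{⊗n}`. -/
abbrev TensorPower : Type _ := UniformSpace.Completion (AlgTensorPower H n)

variable {H} in
/-- The tensor `φ^{⊗n}`. -/
def tensorPow (φ : H) : TensorPower H n := (AlgTensorPower.pure fun _ : Fin n => φ :)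

/-- The symmetric tensor power `H^{⊙n}`, the closed subspace of `H^{⊗n}` generated by the tensors
`φ^{⊗n}`; by polarization it is the space of all symmetric tensors. -/
def symTensorPower : Submodule ℝ (TensorPower H n) :=
  (Submodule.span ℝ (Set.range (tensorPow (H := H) n))).topologicalClosure

variable {H} in
/-- The tensor `φ^{⊗n}`, as an element of `H^{⊙n}`. -/
def symPow (φ : H) : symTensorPower H n :=
  ⟨tensorPow n φ, Submodule.le_topologicalClosure _ (Submodule.subset_span ⟨φ, rfl⟩)⟩

end Tensor

/-! ### Multiple integrals, Hermite variations and the Hermite sheet -/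

/-- The Hermite polynomial `Hₙ(x) = ((-1)ⁿ / n!) e^{x²/2} (d/dx)ⁿ e^{-x²/2}`. -/
def hermitePoly (n : ℕ) (x : ℝ) : ℝ := Polynomial.aeval x (Polynomial.hermite n) / n.factorial

/-- The constant `κ_γ` (which depends also on the order `q`). -/
def kappa (q : ℕ) (γ : ℝ) : ℝ :=
  γ ^ q * (2 * γ - 1) ^ q / ((γ * q - q + 1) * (2 * γ * q - 2 * q + 1))

/-- The normalization `φ(α, β, N, M)`. -/
def normalization (q : ℕ) (α β : ℝ) (N M : ℕ) : ℝ :=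
  √(q.factorial / (kappa q α * kappa q β)) * (N : ℝ) ^ (q - 1) * (M : ℝ) ^ (q - 1)

section Variations

variable {Ω : Type*} [MeasurableSpace Ω] {α β : ℝ} {W : I × I → Ω → ℝ} {P : Measure Ω}

variable (α β W) in
/-- The Hermite variation `V_{N,M}` of order `q`. -/
def hermiteVariation (q N M : ℕ) (ω : Ω) : ℝ :=
  ∑ i ∈ Finset.range N, ∑ j ∈ Finset.range M,
    hermitePoly q ((N : ℝ) ^ α * (M : ℝ) ^ β *
      (W (gridPoint N (i + 1), gridPoint M (j + 1)) ω - W (gridPoint N i, gridPoint M (j + 1)) ω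
        - W (gridPoint N (i + 1), gridPoint M j) ω + W (gridPoint N i, gridPoint M j) ω))

variable (hW : IsFractionalBrownianSheet α β W P) (q : ℕ)

/-- `J` is the multiple integral of order `q`: the linear map on `H^{⊙q}` that takes `φ^{⊗q}` to
`q! H_q(W(φ))` for every unit vector `φ`, and that is isometric up to the factor `q!`. -/
structure IsMultipleIntegral (J : symTensorPower (CanonicalSpace hW) q →L[ℝ] Lp ℝ 2 P) :
    Prop where
  map_symPow : ∀ φ : CanonicalSpace hW, ‖φ‖ = 1 →
    ∀ᵐ ω ∂P, J (symPow q φ) ω = q.factorial * hermitePoly q (wiener hW φ ω)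
  norm_sq : ∀ f, ‖J f‖ ^ 2 = q.factorial * ‖f‖ ^ 2

open Classical in
/-- The multiple integral `I_q` with respect to the sheet. -/
def multipleIntegral : symTensorPower (CanonicalSpace hW) q →L[ℝ] Lp ℝ 2 P :=
  if h : ∃ J, IsMultipleIntegral hW q J then h.choose else 0

/-- The renormalized Hermite variation
`Ṽ_{N,M} = (1/q!) φ(α,β,N,M) ∑ᵢ ∑ⱼ I_q(𝟏_{[i/N,(i+1)/N]×[j/M,(j+1)/M]}^{⊗q})`. -/
def renormalizedVariation (N M : ℕ) : Lp ℝ 2 P :=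
  (1 / (q.factorial : ℝ) * normalization q α β N M) •
    ∑ i ∈ Finset.range N, ∑ j ∈ Finset.range M, multipleIntegral hW q (symPow q (cell hW N M i j))

/-- The kernel `h_{N,M}(t, s)`, with the sums over `0 ≤ i ≤ [(N-1)t]` and `0 ≤ j ≤ [(M-1)s]`;
`h_{N,M}(1, 1)` is the kernel of `Ṽ_{N,M}`. -/
def kernel (t s : I) (N M : ℕ) : symTensorPower (CanonicalSpace hW) q :=
  (1 / (q.factorial : ℝ) * normalization q α β N M) •
    ∑ i ∈ Finset.range (⌊((N : ℝ) - 1) * t⌋₊ + 1), ∑ j ∈ Finset.range (⌊((M : ℝ) - 1) * s⌋₊ + 1),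
      symPow q (cell hW N M i j)

/-- The limit `μ^{(q)}_{t,s}` of the kernels `h_{N,M}(t, s)` as `N, M → ∞`. -/
def limitKernel (t s : I) : symTensorPower (CanonicalSpace hW) q :=
  limUnder atTop fun p : ℕ × ℕ => kernel hW q t s p.1 p.2

/-- The Hermite sheet `Z^{(q)}_{t,s} = I_q(μ^{(q)}_{t,s})`. -/
def hermiteSheet (t s : I) : Lp ℝ 2 P := multipleIntegral hW q (limitKernel hW q t s)

end Variations

end HermiteVariations

end

/-! The multiple integral comes from one Gaussian identity. Let `H_n^v` be the `n`-th coefficient of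
`exp (x T - v T² / 2)`. For step functions `f`, `g`, split `g = c f + g'` with `g'` orthogonal to
`f`; then `W(f)` and `W(g')` are independent, the addition formula expands `H_n(W(g))`, and
orthogonality of Hermite polynomials leaves `E[H_n(W(f)) H_n(W(g))] = ⟪f, g⟫ⁿ / n!`
(`StepSpace.integral_varHermite_mul`). So `n! H_n(W(f))` has, up to the factor `n!`, the Gram matrix
of the tensors `f^{⊗n}`, and these are total in the symmetric power. Hence `f^{⊗n} ↦ n! H_n(W(f))`
extends to the whole space (`exists_continuousLinearMap_of_inner_eq`).

The variations converge because their kernels do. The covariance of the sheet is a product, so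
`⟪h_{N,M}, h_{N',M'}⟫` is a constant times two one-parameter factors `(N N')^{q-1} ∑ gridCov ^ q`
(`inner_kernel`). Each factor is the integral of a step function on the plane. Off the diagonal this
tends pointwise to `(γ (2γ - 1) |u - v|^{2γ-2})^q` on `[0,t)²` and to `0` elsewhere, up to a null
set. It is dominated by `8^q |u - v|^{(2γ-2)q}` on the unit square, which is integrable exactly
because `γ > 1 - 1/(2q)` (`exists_tendsto_sum_gridCov`). Since the scalar products have one common
limit as both pairs of indices grow independently, the kernels are Cauchy
(`cauchy_map_of_tendsto_inner`). Finally `Ṽ_{N,M} = I_q(h_{N,M}(1,1))`, and `I_q` is continuous. The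
constants `κ` play no role in the convergence. -/

namespace HermiteVariations

open Polynomial

/-! ### Hermite polynomials with variance parameter -/

/-- The Hermite polynomial of variance `v`, divided by `n!`: the coefficient of `Tⁿ` in
`exp (x T - v T² / 2)`. -/
noncomputable def varHermite (v : ℝ) : ℕ → ℝ[X]
  | 0 => 1
  | 1 => X
  | n + 2 => C (1 / ((n : ℝ) + 2)) * (X * varHermite v (n + 1) - C v * varHermite v n)

theorem varHermite_succ_succ (v : ℝ) (n : ℕ) :
    C ((n : ℝ) + 2) * varHermite v (n + 2) =
      X * varHermite v (n + 1) - C v * varHermite v n := by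
  have h : ((n : ℝ) + 2) * (1 / ((n : ℝ) + 2)) = 1 := by field_simp
  rw [varHermite, ← mul_assoc, ← C_mul, h]
  simp

theorem eval_varHermite_succ_succ (v x : ℝ) (n : ℕ) :
    ((n : ℝ) + 2) * (varHermite v (n + 2)).eval x =
      x * (varHermite v (n + 1)).eval x - v * (varHermite v n).eval x := by
  simpa using congrArg (eval x) (varHermite_succ_succ v n)

/-- The generating function is multiplied by `T` when differentiated in `x`. Here the relation is
drawn from the three-term recursion by induction. -/
theorem derivative_varHermite (v : ℝ) (n : ℕ) :
    derivative (varHermite v (n + 1)) = varHermite v n := by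
  induction n using Nat.strong_induction_on with
  | _ n ih =>
    match n with
    | 0 => simp [varHermite]
    | 1 =>
      have h := congrArg derivative (varHermite_succ_succ v 0)
      simp only [derivative_mul, derivative_C, derivative_sub, derivative_X, varHermite] at h ⊢
      simp at h ⊢
      rw [show (X + X : ℝ[X]) = C 2 * X by rw [C_ofNat]; ring, ← mul_assoc, ← C_mul]
      norm_num
    | k + 2 =>
      have h := congrArg derivative (varHermite_succ_succ v (k + 1))
      simp only [derivative_mul, derivative_C, derivative_sub, derivative_X, ih (k + 1) (by omega),
        ih k (by omega), zero_mul, zero_add, one_mul] at h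
      have e := varHermite_succ_succ v k
      have hne : (C ((k : ℝ) + 3) : ℝ[X]) ≠ 0 := by
        rw [Ne, C_eq_zero]; positivity
      refine mul_left_cancel₀ hne ?_
      have c1 : (C (((k + 1 : ℕ) : ℝ) + 2) : ℝ[X]) = C ((k : ℝ) + 3) := by
        congr 1; push_cast; ring
      have c2 : (C ((k : ℝ) + 3) : ℝ[X]) = C ((k : ℝ) + 2) + 1 := by
        rw [← C_1, ← C_add]; congr 1; ring
      rw [c1] at h
      rw [h, c2]
      linear_combination -e

/-- Substituting `c T` for `T` in the generating function turns `(v, x)` into `(c² v, c x)`. -/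
theorem eval_varHermite_smul (v c x : ℝ) (n : ℕ) :
    (varHermite (c ^ 2 * v) n).eval (c * x) = c ^ n * (varHermite v n).eval x := by
  induction n using Nat.strong_induction_on with
  | _ n ih =>
    match n with
    | 0 => simp [varHermite]
    | 1 => simp [varHermite]
    | k + 2 =>
      have h1 := eval_varHermite_succ_succ (c ^ 2 * v) (c * x) k
      have h2 := eval_varHermite_succ_succ v x k
      rw [ih k (by omega), ih (k + 1) (by omega)] at h1
      have hne : ((k : ℝ) + 2) ≠ 0 := by positivity
      refine mul_left_cancel₀ hne ?_
      rw [h1]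
      linear_combination (-c ^ (k + 2)) * h2

theorem derivative_hermite (n : ℕ) :
    derivative (hermite (n + 1)) = C ((n : ℤ) + 1) * hermite n := by
  induction n with
  | zero => simp
  | succ n ih =>
    rw [hermite_succ (n + 1), derivative_sub, derivative_mul, ih, derivative_mul, hermite_succ n]
    simp
    ring

theorem aeval_hermite (n : ℕ) (x : ℝ) :
    aeval x (hermite n) = n.factorial * (varHermite 1 n).eval x := by
  induction n using Nat.strong_induction_on with
  | _ n ih =>
    match n with
    | 0 => simp [varHermite]
    | 1 => simp [varHermite]
    | k + 2 =>
      have h := eval_varHermite_succ_succ 1 x k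
      rw [hermite_succ, derivative_hermite, map_sub, map_mul, map_mul, aeval_X, ih k (by omega),
        ih (k + 1) (by omega)]
      simp only [Nat.factorial_succ]
      simp
      linear_combination (-((k : ℝ) + 1) * k.factorial) * h

theorem hermitePoly_eq_eval (n : ℕ) (x : ℝ) : hermitePoly n x = (varHermite 1 n).eval x := by
  rw [hermitePoly, aeval_hermite]
  field_simp

/-- The generating function `exp (x T - v T² / 2)` as a formal power series. -/
noncomputable def hermiteSeries (v x : ℝ) : PowerSeries ℝ :=
  PowerSeries.mk fun n => (varHermite v n).eval x

theorem derivative_hermiteSeries (v x : ℝ) :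
    PowerSeries.derivative ℝ (hermiteSeries v x) =
      (PowerSeries.C x - PowerSeries.C v * PowerSeries.X) * hermiteSeries v x := by
  ext n
  rw [PowerSeries.coeff_derivative, sub_mul, map_sub, mul_assoc,
    PowerSeries.coeff_C_mul, PowerSeries.coeff_C_mul]
  cases n with
  | zero => simp [hermiteSeries, varHermite]
  | succ n =>
    rw [PowerSeries.coeff_succ_X_mul]
    simp only [hermiteSeries, PowerSeries.coeff_mk]
    have h := eval_varHermite_succ_succ v x n
    push_cast
    linear_combination h

/-- A formal linear differential equation of first order determines each coefficient from the
earlier ones. This replaces any appeal to the exponential series. -/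
theorem hermiteSeries_unique {v x : ℝ} {F : PowerSeries ℝ} (h0 : PowerSeries.constantCoeff F = 1)
    (h : PowerSeries.derivative ℝ F = (PowerSeries.C x - PowerSeries.C v * PowerSeries.X) * F) :
    F = hermiteSeries v x := by
  have key : ∀ n, PowerSeries.coeff n F = (varHermite v n).eval x := by
    have hd : ∀ n, PowerSeries.coeff (n + 1) F * ((n : ℝ) + 1) = x * PowerSeries.coeff n F -
        v * PowerSeries.coeff n (PowerSeries.X * F) := fun n => by
      have := congrArg (PowerSeries.coeff n) h
      rw [PowerSeries.coeff_derivative, sub_mul, map_sub,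
        mul_assoc, PowerSeries.coeff_C_mul, PowerSeries.coeff_C_mul] at this
      exact this
    intro n
    induction n using Nat.strong_induction_on with
    | _ n ih =>
      match n with
      | 0 => simpa [varHermite] using h0
      | 1 => simpa [varHermite, h0] using hd 0
      | k + 2 =>
        have h1 := hd (k + 1)
        rw [PowerSeries.coeff_succ_X_mul, ih k (by omega), ih (k + 1) (by omega)] at h1
        have h2 := eval_varHermite_succ_succ v x k
        have hne : ((k : ℝ) + 2) ≠ 0 := by positivity
        refine mul_left_cancel₀ hne ?_
        push_cast at h1
        linear_combination h1 - h2
  ext n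
  simp [key, hermiteSeries]

theorem hermiteSeries_add (u v x y : ℝ) :
    hermiteSeries (u + v) (x + y) = hermiteSeries u x * hermiteSeries v y := by
  refine (hermiteSeries_unique ?_ ?_).symm
  · simp [hermiteSeries, varHermite]
  · rw [Derivation.leibniz, derivative_hermiteSeries, derivative_hermiteSeries]
    simp only [smul_eq_mul, map_add]
    ring

/-- Exponents add in the generating function. The formula serves to separate the two independent
parts of a Gaussian variable. -/
theorem eval_varHermite_add (u v x y : ℝ) (n : ℕ) :
    (varHermite (u + v) n).eval (x + y) = ∑ k ∈ Finset.HasAntidiagonal.antidiagonal n,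
      (varHermite u k.1).eval x * (varHermite v k.2).eval y := by
  have h := congrArg (PowerSeries.coeff n) (hermiteSeries_add u v x y)
  rw [PowerSeries.coeff_mul] at h
  simpa [hermiteSeries] using h

/-! ### Orthogonality with respect to the Gaussian law -/

theorem integrable_eval_gaussianReal (p : ℝ[X]) (m : ℝ) (v : NNReal) :
    Integrable (fun x => p.eval x) (gaussianReal m v) := by
  simp only [eval_eq_sum_range]
  refine integrable_finsetSum _ fun i _ => Integrable.const_mul ?_ _
  have h := (memLp_id_gaussianReal (μ := m) (v := v) i).integrable_norm_pow'
  refine h.mono' (by fun_prop) (ae_of_all _ fun x => ?_)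
  simp

/-- Integration by parts against the density, whose derivative is `-(x / v)` times itself. For `v =
0` the law is the Dirac mass at `0` and both sides vanish. -/
theorem integral_id_mul_eval_gaussianReal (p : ℝ[X]) (v : NNReal) :
    ∫ x, x * p.eval x ∂gaussianReal 0 v = v * ∫ x, (derivative p).eval x ∂gaussianReal 0 v := by
  rcases eq_or_ne v 0 with rfl | hv
  · simp [gaussianReal_zero_var]
  have hint : ∀ r : ℝ[X], Integrable (fun x => r.eval x * gaussianPDFReal 0 v x) := fun r => by
    have h := integrable_eval_gaussianReal r 0 v
    rw [gaussianReal_of_var_ne_zero _ hv, integrable_withDensity_iff_integrable_smul'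
      (measurable_gaussianPDF _ _) (ae_of_all _ fun x => gaussianPDF_lt_top)] at h
    refine h.congr (ae_of_all _ fun x => ?_)
    simp [toReal_gaussianPDF, mul_comm]
  have hd : ∀ x, HasDerivAt (gaussianPDFReal 0 v) (-(x / v) * gaussianPDFReal 0 v x) x := by
    intro x
    have hv' : (v : ℝ) ≠ 0 := by exact_mod_cast hv
    have h1 : HasDerivAt (fun x : ℝ => -(x - 0) ^ 2 / (2 * v)) (-(x / v)) x := by
      have := (((hasDerivAt_id x).sub_const 0).pow 2).neg.div_const (2 * (v : ℝ))
      refine this.congr_deriv ?_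
      simp
      field_simp
    have h2 := (h1.exp).const_mul (√(2 * Real.pi * v))⁻¹
    rw [gaussianPDFReal_def]
    refine h2.congr_deriv ?_
    ring
  have hp := integral_mul_deriv_eq_deriv_mul_of_integrable (u := fun x => p.eval x)
    (v := gaussianPDFReal 0 v) (u' := fun x => (derivative p).eval x)
    (v' := fun x => -(x / v) * gaussianPDFReal 0 v x) (fun x _ => p.hasDerivAt x)
    (fun x _ => hd x) ?_ (hint _) (hint _)
  · rw [integral_gaussianReal_eq_integral_smul hv, integral_gaussianReal_eq_integral_smul hv]
    have hv' : (v : ℝ) ≠ 0 := by exact_mod_cast hv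
    have e1 : ∫ x, gaussianPDFReal 0 v x • (x * p.eval x) =
        -v * ∫ x, p.eval x * (-(x / v) * gaussianPDFReal 0 v x) := by
      rw [← integral_const_mul]
      congr 1
      ext x
      simp only [smul_eq_mul]
      field_simp
    rw [e1, hp]
    simp [mul_comm]
  · refine ((hint (C (-1 / (v : ℝ)) * X * p))).congr (ae_of_all _ fun x => ?_)
    simp
    ring

/-- Integration by parts of `x H_n H_{m+1}` produces two terms, and the recursion for `H_{n+1}`
cancels one of them. Both degrees drop together, which leads to orthogonality. -/
theorem integral_varHermite_mul_succ (v : NNReal) (n m : ℕ) :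
    ((n : ℝ) + 1) * ∫ x, (varHermite v (n + 1)).eval x * (varHermite v (m + 1)).eval x
        ∂gaussianReal 0 v =
      v * ∫ x, (varHermite v n).eval x * (varHermite v m).eval x ∂gaussianReal 0 v := by
  have I1 : ∀ r s : ℝ[X], Integrable (fun x => r.eval x * s.eval x) (gaussianReal 0 v) :=
    fun r s => by simpa using integrable_eval_gaussianReal (r * s) 0 v
  cases n with
  | zero =>
    have h := integral_id_mul_eval_gaussianReal (varHermite v (m + 1)) v
    rw [derivative_varHermite] at h
    simpa [varHermite] using h
  | succ n =>
    have h := integral_id_mul_eval_gaussianReal (varHermite v (n + 1) * varHermite v (m + 1)) v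
    rw [derivative_mul, derivative_varHermite, derivative_varHermite] at h
    simp only [eval_add, eval_mul] at h
    rw [integral_add (I1 _ _) (I1 _ _)] at h
    have e : ∀ x, ((n : ℝ) + 2) * ((varHermite v (n + 2)).eval x * (varHermite v (m + 1)).eval x) =
        x * ((varHermite v (n + 1)).eval x * (varHermite v (m + 1)).eval x) -
          v * ((varHermite v n).eval x * (varHermite v (m + 1)).eval x) := fun x => by
      linear_combination ((varHermite v (m + 1)).eval x) * eval_varHermite_succ_succ v x n
    have h2 : ((n : ℝ) + 2) * ∫ x, (varHermite v (n + 2)).eval x * (varHermite v (m + 1)).eval x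
        ∂gaussianReal 0 v =
        v * ∫ x, (varHermite v (n + 1)).eval x * (varHermite v m).eval x ∂gaussianReal 0 v := by
      rw [← integral_const_mul]
      simp only [e]
      rw [integral_sub _ ((I1 _ _).const_mul _), h, integral_const_mul]
      · ring
      · exact (I1 (X * varHermite v (n + 1)) (varHermite v (m + 1))).congr
          (ae_of_all _ fun x => by simp [mul_assoc])
    push_cast
    rw [add_assoc, one_add_one_eq_two, h2]

theorem integral_varHermite_succ (v : NNReal) (n : ℕ) :
    ∫ x, (varHermite v (n + 1)).eval x ∂gaussianReal 0 v = 0 := by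
  cases n with
  | zero => simp [varHermite]
  | succ n =>
    have h := integral_id_mul_eval_gaussianReal (varHermite v (n + 1)) v
    rw [derivative_varHermite] at h
    have h2 : ((n : ℝ) + 2) * ∫ x, (varHermite v (n + 2)).eval x ∂gaussianReal 0 v = 0 := by
      rw [← integral_const_mul]
      simp only [eval_varHermite_succ_succ]
      rw [integral_sub _ ((integrable_eval_gaussianReal _ _ _).const_mul _), h, integral_const_mul,
        sub_self]
      exact (integrable_eval_gaussianReal (X * varHermite v (n + 1)) 0 v).congr
        (ae_of_all _ fun x => by simp)
    exact (mul_eq_zero.1 h2).resolve_left (by positivity)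

theorem integral_varHermite_mul (v : NNReal) (n m : ℕ) :
    ∫ x, (varHermite v n).eval x * (varHermite v m).eval x ∂gaussianReal 0 v =
      if n = m then (v : ℝ) ^ n / n.factorial else 0 := by
  induction n generalizing m with
  | zero =>
    cases m with
    | zero => simp [varHermite]
    | succ m => simpa [varHermite] using integral_varHermite_succ v m
  | succ n ih =>
    cases m with
    | zero => simpa [varHermite] using integral_varHermite_succ v n
    | succ m =>
      have h := integral_varHermite_mul_succ v n m
      rw [ih m] at h
      have hne : ((n : ℝ) + 1) ≠ 0 := by positivity
      refine mul_left_cancel₀ hne ?_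
      rw [h]
      by_cases hnm : n = m
      · simp [hnm, Nat.factorial_succ, pow_succ]
        field_simp
      · simp [hnm]

end HermiteVariations

/-! ### Hermite polynomials of correlated Gaussian variables -/

namespace HermiteVariations

open Polynomial

/-- The addition formula and independence factor every term. A factor `H_b(Z)` with `b > 0` has mean
zero, so only the term of full degree in `X` survives, and homogeneity gives `cⁿ`. -/
theorem integral_varHermite_mul_of_indepFun {Ω : Type*} [MeasurableSpace Ω] {P : Measure Ω}
    {X Z : Ω → ℝ} {u w : NNReal} (hXm : AEMeasurable X P) (hZm : AEMeasurable Z P)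
    (hX : P.map X = gaussianReal 0 u) (hZ : P.map Z = gaussianReal 0 w) (hXZ : IndepFun X Z P)
    (c : ℝ) (n : ℕ) :
    ∫ ω, (varHermite u n).eval (X ω) * (varHermite (c ^ 2 * u + w) n).eval (c * X ω + Z ω) ∂P =
      (c * u) ^ n / n.factorial := by
  have hint : ∀ {Y : Ω → ℝ} {v : NNReal}, AEMeasurable Y P → P.map Y = gaussianReal 0 v →
      ∀ p : ℝ[X], ∫ ω, p.eval (Y ω) ∂P = ∫ x, p.eval x ∂gaussianReal 0 v := by
    intro Y v hYm hY p
    rw [← hY, integral_map hYm (by fun_prop)]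
  have hinteg : ∀ {Y : Ω → ℝ} {v : NNReal}, AEMeasurable Y P → P.map Y = gaussianReal 0 v →
      ∀ p : ℝ[X], Integrable (fun ω => p.eval (Y ω)) P := by
    intro Y v hYm hY p
    have := integrable_eval_gaussianReal p 0 v
    rw [← hY] at this
    exact this.comp_aemeasurable hYm
  have hm : ∀ p : ℝ[X], Measurable fun x => p.eval x := fun p => p.continuous.measurable
  have hind : ∀ p r : ℝ[X], IndepFun (fun ω => p.eval (X ω)) (fun ω => r.eval (Z ω)) P :=
    fun p r => hXZ.comp (hm p) (hm r)
  have e : ∀ ω, (varHermite u n).eval (X ω) *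
      (varHermite (c ^ 2 * u + w) n).eval (c * X ω + Z ω) =
      ∑ k ∈ Finset.HasAntidiagonal.antidiagonal n,
        c ^ k.1 * ((varHermite u n * varHermite u k.1).eval (X ω) *
          (varHermite w k.2).eval (Z ω)) := by
    intro ω
    rw [eval_varHermite_add, Finset.mul_sum]
    refine Finset.sum_congr rfl fun k _ => ?_
    rw [eval_varHermite_smul, eval_mul]
    ring
  simp only [e]
  rw [integral_finsetSum]
  · have h2 : ∀ k ∈ Finset.HasAntidiagonal.antidiagonal n,
        ∫ ω, c ^ k.1 * ((varHermite u n * varHermite u k.1).eval (X ω) *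
          (varHermite w k.2).eval (Z ω)) ∂P =
        if k = (n, 0) then (c * u) ^ n / n.factorial else 0 := by
      rintro ⟨a, b⟩ hk
      have hab := Finset.HasAntidiagonal.mem_antidiagonal.1 hk
      simp only at hab ⊢
      rw [integral_const_mul, (hind _ _).integral_fun_mul_eq_mul_integral
        (hinteg hXm hX _).aestronglyMeasurable (hinteg hZm hZ _).aestronglyMeasurable,
        hint hXm hX, hint hZm hZ]
      simp only [eval_mul]
      rw [integral_varHermite_mul]
      cases b with
      | zero =>
        obtain rfl : a = n := by omega
        simp [varHermite, mul_pow]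
        ring
      | succ b =>
        rw [integral_varHermite_succ]
        simp
    rw [Finset.sum_congr rfl h2, Finset.sum_ite_eq' ]
    simp
  · intro k _
    exact ((hind _ _).integrable_mul (hinteg hXm hX _) (hinteg hZm hZ _)).const_mul _

/-! ### Integrals of step functions -/

section Step

variable {Ω : Type*} [MeasurableSpace Ω] {α β : ℝ} {W : I × I → Ω → ℝ} {P : Measure Ω}
variable (hW : IsFractionalBrownianSheet α β W P)

theorem inner_Lp_eq_integral (f g : Lp ℝ 2 P) : ⟪f, g⟫ = ∫ ω, f ω * g ω ∂P := by
  rw [L2.inner_def]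
  simp [mul_comm]

theorem StepSpace.integral_coeFn (f : StepSpace hW) :
    StepSpace.integral hW f =ᵐ[P]
      fun ω => ∑ p ∈ ((StepSpace.of hW).symm f).support, ((StepSpace.of hW).symm f) p * W p ω := by
  simp only [integral, LinearMap.comp_apply, LinearEquiv.coe_coe,
    Finsupp.linearCombination_apply, Finsupp.sum]
  refine (Lp.coeFn_finsetSum _ _).trans ?_
  have h : ∀ p : I × I, ∀ᵐ ω ∂P, (((StepSpace.of hW).symm f) p • (hW.memLp p).toLp (W p) :
      Lp ℝ 2 P) ω = ((StepSpace.of hW).symm f) p * W p ω := by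
    intro p
    filter_upwards [Lp.coeFn_smul (((StepSpace.of hW).symm f) p) ((hW.memLp p).toLp (W p)),
      (hW.memLp p).coeFn_toLp] with ω h1 h2
    rw [h1, Pi.smul_apply, h2, smul_eq_mul]
  have h' : ∀ᵐ ω ∂P, ∀ p ∈ ((StepSpace.of hW).symm f).support,
      (((StepSpace.of hW).symm f) p • (hW.memLp p).toLp (W p) :
      Lp ℝ 2 P) ω = ((StepSpace.of hW).symm f) p * W p ω :=
    (Finset.eventually_all _).2 fun p _ => h p
  filter_upwards [h'] with ω hω
  rw [Finset.sum_apply]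
  exact Finset.sum_congr rfl hω

theorem StepSpace.isGaussianProcess_integral :
    IsGaussianProcess (fun f : StepSpace hW => (StepSpace.integral hW f : Ω → ℝ)) P := by
  refine IsGaussianProcess.congr (X := fun f : StepSpace hW => fun ω =>
    ∑ p ∈ ((StepSpace.of hW).symm f).support, ((StepSpace.of hW).symm f) p * W p ω) ?_
    fun f => (integral_coeFn hW f).symm
  refine hW.gaussian.of_isGaussianProcess fun f =>
    ⟨((StepSpace.of hW).symm f).support,
      ∑ p, ((StepSpace.of hW).symm f) p.1 • ContinuousLinearMap.proj p, fun ω => ?_⟩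
  simp only [sum_apply, smul_apply,
    ContinuousLinearMap.proj_apply, Finset.restrict_def, smul_eq_mul]
  exact (Finset.sum_coe_sort _ fun p => ((StepSpace.of hW).symm f) p * W p ω).symm

theorem StepSpace.integral_integral_eq_zero (f : StepSpace hW) :
    ∫ ω, StepSpace.integral hW f ω ∂P = 0 := by
  have := hW.gaussian.isProbabilityMeasure
  rw [integral_congr_ae (integral_coeFn hW f), integral_finsetSum]
  · simp [integral_const_mul, hW.centered]
  · intro p _
    exact ((hW.memLp p).integrable (by norm_num)).const_mul _

theorem StepSpace.inner_def (f g : StepSpace hW) :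
    ⟪f, g⟫ = ∫ ω, StepSpace.integral hW f ω * StepSpace.integral hW g ω ∂P := by
  rw [← inner_Lp_eq_integral]
  exact ((StepSpace.integralIsometry hW).inner_map_map f g).symm

theorem StepSpace.map_integral (f : StepSpace hW) :
    P.map (StepSpace.integral hW f) = gaussianReal 0 (‖f‖₊ ^ 2) := by
  have := hW.gaussian.isProbabilityMeasure
  have h := ((isGaussianProcess_integral hW).hasGaussianLaw_eval f).map_eq_gaussianReal
  rw [h, integral_integral_eq_zero]
  congr 1
  rw [variance_of_integral_eq_zero (Lp.aestronglyMeasurable _).aemeasurable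
    (integral_integral_eq_zero hW f)]
  have e : ∫ ω, StepSpace.integral hW f ω ^ 2 ∂P = ‖f‖ ^ 2 := by
    rw [← real_inner_self_eq_norm_sq, inner_def]
    simp only [sq]
  rw [e]
  ext
  simp

/-- Projecting `g` on `f` leaves an orthogonal remainder. For jointly Gaussian variables
uncorrelated means independent, which reduces the claim to the independent case. -/
theorem StepSpace.integral_varHermite_mul (f g : StepSpace hW) (n : ℕ) :
    ∫ ω, (varHermite (‖f‖ ^ 2) n).eval (StepSpace.integral hW f ω) *
      (varHermite (‖g‖ ^ 2) n).eval (StepSpace.integral hW g ω) ∂P = ⟪f, g⟫ ^ n / n.factorial := by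
  have := hW.gaussian.isProbabilityMeasure
  -- The norm is only a seminorm. If it vanishes at `f`, Cauchy–Schwarz gives `⟪f, g⟫ = 0` and `c =
  -- 0` will do.
  obtain ⟨c, hc⟩ : ∃ c : ℝ, c * ‖f‖ ^ 2 = ⟪f, g⟫ := by
    rcases eq_or_ne ‖f‖ 0 with h0 | h0
    · refine ⟨0, ?_⟩
      have := abs_real_inner_le_norm f g
      rw [h0, zero_mul] at this
      rw [abs_nonpos_iff.1 this, zero_mul]
    · exact ⟨⟪f, g⟫ / ‖f‖ ^ 2, by field_simp⟩
  have h0 : ⟪f, g - c • f⟫ = 0 := by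
    rw [inner_sub_right, inner_smul_right, real_inner_self_eq_norm_sq, hc, sub_self]
  have hind : IndepFun (StepSpace.integral hW f : Ω → ℝ)
      (StepSpace.integral hW (g - c • f) : Ω → ℝ) P := by
    refine ((isGaussianProcess_integral hW).hasGaussianLaw_prodMk
      (s := f) (t := g - c • f)).indepFun_of_covariance_eq_zero ?_
    rw [covariance_eq_sub (Lp.memLp _) (Lp.memLp _), integral_integral_eq_zero, zero_mul, sub_zero]
    rw [inner_def] at h0
    exact h0
  have hm : ∀ f : StepSpace hW, AEMeasurable (StepSpace.integral hW f) P :=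
    fun f => (Lp.aestronglyMeasurable _).aemeasurable
  have key := integral_varHermite_mul_of_indepFun (hm f) (hm _) (map_integral hW f)
    (map_integral hW _) hind c n
  have hn : ‖g‖ ^ 2 = c ^ 2 * ‖f‖ ^ 2 + ‖g - c • f‖ ^ 2 := by
    have e : g = c • f + (g - c • f) := by abel
    conv_lhs => rw [e]
    rw [← real_inner_self_eq_norm_sq, inner_add_add_self, inner_smul_left, inner_smul_right,
      inner_smul_right, inner_smul_left, real_inner_self_eq_norm_sq, h0, real_inner_comm, h0,
      real_inner_self_eq_norm_sq]
    simp
    ring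
  have hg : ∀ᵐ ω ∂P, StepSpace.integral hW g ω =
      c * StepSpace.integral hW f ω + StepSpace.integral hW (g - c • f) ω := by
    have e : StepSpace.integral hW g =
        c • StepSpace.integral hW f + StepSpace.integral hW (g - c • f) := by
      rw [← map_smul, ← map_add]; congr 1; abel
    rw [e]
    filter_upwards [Lp.coeFn_add (c • StepSpace.integral hW f)
      (StepSpace.integral hW (g - c • f)), Lp.coeFn_smul c (StepSpace.integral hW f)] with ω h1 h2
    rw [h1, Pi.add_apply, h2, Pi.smul_apply, smul_eq_mul]
  simp only [NNReal.coe_pow, coe_nnnorm] at key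
  rw [← hn, hc] at key
  rw [← key]
  refine integral_congr_ae ?_
  filter_upwards [hg] with ω hω
  rw [hω]

theorem StepSpace.memLp_eval_integral (f : StepSpace hW) (p : ℝ[X]) :
    MemLp (fun ω => p.eval (StepSpace.integral hW f ω)) 2 P := by
  have hm : AEMeasurable (StepSpace.integral hW f) P := (Lp.aestronglyMeasurable _).aemeasurable
  refine (memLp_two_iff_integrable_sq
    (p.continuous.measurable.comp_aemeasurable hm).aestronglyMeasurable).2 ?_
  have := integrable_eval_gaussianReal (p ^ 2) 0 (‖f‖₊ ^ 2)
  rw [← map_integral hW f] at this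
  simpa [Function.comp_def] using this.comp_aemeasurable hm

/-- The value `n! ‖f‖ⁿ Hₙ(W(f) / ‖f‖)` of the multiple integral at `f^{⊗n}`. -/
noncomputable def StepSpace.hermiteIntegral (n : ℕ) (f : StepSpace hW) : Lp ℝ 2 P :=
  (n.factorial : ℝ) • (memLp_eval_integral hW f (varHermite (‖f‖ ^ 2) n)).toLp _

theorem StepSpace.inner_hermiteIntegral (n : ℕ) (f g : StepSpace hW) :
    ⟪hermiteIntegral hW n f, hermiteIntegral hW n g⟫ = n.factorial * ⟪f, g⟫ ^ n := by
  rw [hermiteIntegral, hermiteIntegral, inner_smul_left, inner_smul_right, inner_Lp_eq_integral]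
  have e : ∫ ω, (memLp_eval_integral hW f (varHermite (‖f‖ ^ 2) n)).toLp _ ω *
      (memLp_eval_integral hW g (varHermite (‖g‖ ^ 2) n)).toLp _ ω ∂P =
      ⟪f, g⟫ ^ n / n.factorial := by
    rw [← integral_varHermite_mul]
    refine integral_congr_ae ?_
    filter_upwards [(memLp_eval_integral hW f (varHermite (‖f‖ ^ 2) n)).coeFn_toLp,
      (memLp_eval_integral hW g (varHermite (‖g‖ ^ 2) n)).coeFn_toLp] with ω h1 h2
    rw [h1, h2]
  rw [e, RCLike.conj_to_real]
  field_simp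

end Step

end HermiteVariations

namespace HermiteVariations

/-! ### Symmetric tensor powers and total families -/

section Tensor

variable {H : Type*} [NormedAddCommGroup H] [InnerProductSpace ℝ H] (n : ℕ)

theorem inner_tensorPow (φ ψ : H) : ⟪tensorPow n φ, tensorPow n ψ⟫ = ⟪φ, ψ⟫ ^ n := by
  rw [tensorPow, tensorPow, UniformSpace.Completion.inner_coe]
  change AlgTensorPower.form H n _ _ = _
  rw [AlgTensorPower.form_pure]
  simp

theorem inner_symPow (φ ψ : H) : ⟪symPow n φ, symPow n ψ⟫ = ⟪φ, ψ⟫ ^ n :=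
  inner_tensorPow n φ ψ

theorem tensorPow_smul (c : ℝ) (φ : H) : tensorPow n (c • φ) = c ^ n • tensorPow n φ := by
  rw [tensorPow, tensorPow, ← UniformSpace.Completion.coe_smul]
  congr 1
  have := (PiTensorProduct.tprod ℝ (s := fun _ : Fin n => H)).map_smul_univ (fun _ => c)
    (fun _ => φ)
  simp only [Finset.prod_const, Finset.card_univ, Fintype.card_fin] at this
  exact this

theorem symPow_smul (c : ℝ) (φ : H) : symPow n (c • φ) = c ^ n • symPow n φ :=
  Subtype.ext (tensorPow_smul n c φ)

/-- The distance between two powers is an explicit continuous function of scalar products in `H`. -/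
theorem continuous_symPow : Continuous (symPow n : H → symTensorPower H n) := by
  rw [continuous_iff_continuousAt]
  intro φ
  rw [ContinuousAt, tendsto_iff_norm_sub_tendsto_zero]
  have e : ∀ ψ : H, ‖symPow n ψ - symPow n φ‖ =
      √(⟪ψ, ψ⟫ ^ n - 2 * ⟪ψ, φ⟫ ^ n + ⟪φ, φ⟫ ^ n) := by
    intro ψ
    rw [← inner_symPow, ← inner_symPow, ← inner_symPow, real_inner_self_eq_norm_sq,
      real_inner_self_eq_norm_sq, ← norm_sub_sq_real, Real.sqrt_sq (norm_nonneg _)]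
  simp only [e]
  have hc : Continuous fun ψ : H => √(⟪ψ, ψ⟫ ^ n - 2 * ⟪ψ, φ⟫ ^ n + ⟪φ, φ⟫ ^ n) := by
    fun_prop
  have := hc.tendsto φ
  simpa [two_mul] using this

theorem closure_span_symPow :
    closure (Submodule.span ℝ (Set.range (symPow (H := H) n)) : Set (symTensorPower H n)) =
      Set.univ := by
  rw [Set.eq_univ_iff_forall]
  intro x
  rw [closure_subtype]
  have e : Subtype.val '' (Submodule.span ℝ (Set.range (symPow (H := H) n)) :
      Set (symTensorPower H n)) = Submodule.span ℝ (Set.range (tensorPow (H := H) n)) := by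
    have : (Submodule.span ℝ (Set.range (symPow (H := H) n))).map
        (symTensorPower H n).subtype = Submodule.span ℝ (Set.range (tensorPow (H := H) n)) := by
      rw [Submodule.map_span, ← Set.range_comp]
      rfl
    rw [← this]
    rfl
  rw [e]
  exact x.2

theorem closure_span_symPow_of_denseRange {X : Type*} {u : X → H} (hu : DenseRange u) :
    closure (Submodule.span ℝ (Set.range fun x => symPow n (u x)) : Set (symTensorPower H n)) =
      Set.univ := by
  set S := (Submodule.span ℝ (Set.range fun x => symPow n (u x))).topologicalClosure
  have h1 : ∀ φ : H, symPow n φ ∈ S := fun φ =>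
    hu.induction_on (p := fun φ => symPow n φ ∈ S) φ
      ((Submodule.isClosed_topologicalClosure _).preimage (continuous_symPow n))
      fun x => Submodule.le_topologicalClosure _ (Submodule.subset_span ⟨x, rfl⟩)
  have h2 : Submodule.span ℝ (Set.range (symPow (H := H) n)) ≤ S := by
    rw [Submodule.span_le]
    rintro _ ⟨φ, rfl⟩
    exact h1 φ
  have h3 := closure_mono (s := (Submodule.span ℝ (Set.range (symPow (H := H) n)) :
      Set (symTensorPower H n))) (t := S) h2
  rw [closure_span_symPow, (Submodule.isClosed_topologicalClosure _).closure_eq] at h3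
  exact Set.univ_subset_iff.1 h3

end Tensor

/-! ### Extension of isometries from total families -/

section Extension

variable {E F X : Type*} [NormedAddCommGroup E] [InnerProductSpace ℝ E] [NormedAddCommGroup F]
  [InnerProductSpace ℝ F] [CompleteSpace F]

/-- Proportional Gram matrices make the norms of corresponding linear combinations proportional.
Thus every linear relation among the `v x` holds among the `w x`, and the map on the span is bounded
and extends by density. -/
theorem exists_continuousLinearMap_of_inner_eq {v : X → E} {w : X → F} {c : ℝ} (hc : 0 ≤ c)
    (hv : closure (Submodule.span ℝ (Set.range v) : Set E) = Set.univ)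
    (h : ∀ x y, ⟪w x, w y⟫ = c * ⟪v x, v y⟫) :
    ∃ J : E →L[ℝ] F, (∀ x, J (v x) = w x) ∧ ∀ f, ‖J f‖ ^ 2 = c * ‖f‖ ^ 2 := by
  have hsq : ∀ a : X →₀ ℝ, ‖Finsupp.linearCombination ℝ w a‖ ^ 2 =
      c * ‖Finsupp.linearCombination ℝ v a‖ ^ 2 := by
    intro a
    simp only [← real_inner_self_eq_norm_sq, Finsupp.linearCombination_apply, Finsupp.sum,
      sum_inner, inner_sum, inner_smul_left, inner_smul_right, h, Finset.mul_sum]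
    refine Finset.sum_congr rfl fun x _ => Finset.sum_congr rfl fun y _ => ?_
    ring
  have hd : DenseRange (Finsupp.linearCombination ℝ v) := by
    have e : Set.range (Finsupp.linearCombination ℝ v) = (Submodule.span ℝ (Set.range v) : Set E) := by
      rw [← Finsupp.range_linearCombination]
      rfl
    rw [DenseRange, e, dense_iff_closure_eq, hv]
  have hb : ∃ C : ℝ, ∀ a, ‖Finsupp.linearCombination ℝ w a‖ ≤
      C * ‖Finsupp.linearCombination ℝ v a‖ := by
    refine ⟨√c, fun a => ?_⟩
    rw [← Real.sqrt_sq (norm_nonneg (Finsupp.linearCombination ℝ v a)), ← Real.sqrt_mul hc, ← hsq,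
      Real.sqrt_sq (norm_nonneg _)]
  have key := LinearMap.extendOfNorm_eq hd hb
  refine ⟨(Finsupp.linearCombination ℝ w).extendOfNorm (Finsupp.linearCombination ℝ v),
    fun x => ?_, fun f => ?_⟩
  · simpa using key (.single x 1)
  · refine hd.induction_on f (isClosed_eq (by fun_prop) (by fun_prop)) fun a => ?_
    rw [key, hsq]

end Extension

/-! ### Existence and uniqueness of the multiple integral -/

section MultipleIntegral

variable {Ω : Type*} [MeasurableSpace Ω] {α β : ℝ} {W : I × I → Ω → ℝ} {P : Measure Ω}
variable (hW : IsFractionalBrownianSheet α β W P) (q : ℕ)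

theorem wiener_coe (f : StepSpace hW) :
    wiener hW (f : CanonicalSpace hW) = StepSpace.integral hW f :=
  ContinuousLinearMap.extend_eq (StepSpace.integralIsometry hW).toContinuousLinearMap
    (e := UniformSpace.Completion.toComplL) UniformSpace.Completion.denseRange_coe
    (UniformSpace.Completion.isUniformInducing_coe _) f

theorem continuous_eval_varHermite :
    Continuous fun z : ℝ × ℝ => (varHermite z.1 q).eval z.2 := by
  induction q using Nat.strong_induction_on with
  | _ n ih =>
    match n with
    | 0 => simpa [varHermite] using continuous_const
    | 1 => simpa [varHermite] using continuous_snd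
    | k + 2 =>
      have h1 := ih k (by omega)
      have h2 := ih (k + 1) (by omega)
      simp only [varHermite, Polynomial.eval_mul, Polynomial.eval_sub, Polynomial.eval_C,
        Polynomial.eval_X]
      fun_prop

/-- The variance parameter allows a formula for all `φ`, not only unit vectors, so approximating
step functions need no normalization. Joint continuity in variance and argument carries it to the
limit. -/
theorem exists_multipleIntegral :
    ∃ J : symTensorPower (CanonicalSpace hW) q →L[ℝ] Lp ℝ 2 P,
      (∀ φ : CanonicalSpace hW, ∀ᵐ ω ∂P, J (symPow q φ) ω =
        q.factorial * (varHermite (‖φ‖ ^ 2) q).eval (wiener hW φ ω)) ∧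
      ∀ f, ‖J f‖ ^ 2 = q.factorial * ‖f‖ ^ 2 := by
  obtain ⟨J, hJ, hJn⟩ := exists_continuousLinearMap_of_inner_eq (c := q.factorial)
    (v := fun f : StepSpace hW => symPow q (f : CanonicalSpace hW))
    (w := StepSpace.hermiteIntegral hW q) (by positivity)
    (closure_span_symPow_of_denseRange q UniformSpace.Completion.denseRange_coe)
    (fun f g => by
      rw [StepSpace.inner_hermiteIntegral, inner_symPow, UniformSpace.Completion.inner_coe])
  refine ⟨J, fun φ => ?_, hJn⟩
  obtain ⟨f, hf⟩ : ∃ f : ℕ → StepSpace hW,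
      Tendsto (fun k => (f k : CanonicalSpace hW)) atTop (𝓝 φ) := by
    obtain ⟨x, hx, hxl⟩ := mem_closure_iff_seq_limit.1
      (UniformSpace.Completion.denseRange_coe (α := StepSpace hW) φ)
    choose f hf using hx
    exact ⟨f, by simpa [hf] using hxl⟩
  have hstep : ∀ k, ∀ᵐ ω ∂P, J (symPow q (f k : CanonicalSpace hW)) ω =
      q.factorial * (varHermite (‖(f k : CanonicalSpace hW)‖ ^ 2) q).eval
        (wiener hW (f k : CanonicalSpace hW) ω) := by
    intro k
    rw [hJ, wiener_coe, UniformSpace.Completion.norm_coe, StepSpace.hermiteIntegral]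
    filter_upwards [Lp.coeFn_smul (q.factorial : ℝ) ((StepSpace.memLp_eval_integral hW (f k)
        (varHermite (‖f k‖ ^ 2) q)).toLp _), (StepSpace.memLp_eval_integral hW (f k)
        (varHermite (‖f k‖ ^ 2) q)).coeFn_toLp] with ω h1 h2
    rw [h1, Pi.smul_apply, h2, smul_eq_mul]
  have t1 : Tendsto (fun k => wiener hW (f k : CanonicalSpace hW)) atTop (𝓝 (wiener hW φ)) :=
    ((wiener hW).continuous.tendsto φ).comp hf
  -- Convergence in `L²` gives almost sure convergence only along subsequences. A second extraction
  -- inside the first makes both sides converge simultaneously.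
  obtain ⟨k₁, hk₁, a1⟩ := (tendstoInMeasure_of_tendsto_Lp t1).exists_seq_tendsto_ae
  have hf₁ := hf.comp hk₁.tendsto_atTop
  have t2 : Tendsto (fun k => J (symPow q (f (k₁ k) : CanonicalSpace hW))) atTop
      (𝓝 (J (symPow q φ))) :=
    ((J.continuous.comp (continuous_symPow q)).tendsto φ).comp hf₁
  obtain ⟨k₂, hk₂, a2⟩ := (tendstoInMeasure_of_tendsto_Lp t2).exists_seq_tendsto_ae
  filter_upwards [a1, a2, ae_all_iff.2 hstep] with ω h1 h2 h3
  refine tendsto_nhds_unique h2 ?_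
  simp only [h3]
  refine Tendsto.const_mul _ ?_
  have hn : Tendsto (fun i => ‖(f (k₁ (k₂ i)) : CanonicalSpace hW)‖ ^ 2) atTop (𝓝 (‖φ‖ ^ 2)) :=
    ((hf₁.comp hk₂.tendsto_atTop).norm).pow 2
  exact ((continuous_eval_varHermite q).tendsto (‖φ‖ ^ 2, wiener hW φ ω)).comp
    (hn.prodMk_nhds (h1.comp hk₂.tendsto_atTop))

theorem exists_isMultipleIntegral : ∃ J, IsMultipleIntegral hW q J := by
  obtain ⟨J, h1, h2⟩ := exists_multipleIntegral hW q
  refine ⟨J, fun φ hφ => ?_, h2⟩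
  filter_upwards [h1 φ] with ω hω
  rw [hω, hφ, one_pow, hermitePoly_eq_eval]

/-- Homogeneity reduces every power to that of a unit vector, and the powers are total. The zero
vector is where `q ≠ 0` enters: its power of order `0` is not zero. -/
theorem IsMultipleIntegral.unique (hq : q ≠ 0)
    {J J' : symTensorPower (CanonicalSpace hW) q →L[ℝ] Lp ℝ 2 P}
    (hJ : IsMultipleIntegral hW q J) (hJ' : IsMultipleIntegral hW q J') : J = J' := by
  refine ContinuousLinearMap.ext_on (s := Set.range (symPow q)) ?_ ?_
  · rw [dense_iff_closure_eq]
    exact closure_span_symPow q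
  · rintro _ ⟨φ, rfl⟩
    rcases eq_or_ne φ 0 with rfl | hφ
    · have h : symPow q (0 : CanonicalSpace hW) = 0 := by
        simpa [hq] using symPow_smul q (0 : ℝ) (0 : CanonicalSpace hW)
      simp [h]
    · have h : φ = ‖φ‖ • (‖φ‖⁻¹ • φ) := by
        rw [smul_smul, mul_inv_cancel₀ (norm_ne_zero_iff.2 hφ), one_smul]
      have h1 : ‖‖φ‖⁻¹ • φ‖ = 1 := by
        rw [norm_smul, norm_inv, norm_norm, inv_mul_cancel₀ (norm_ne_zero_iff.2 hφ)]
      rw [h, symPow_smul, map_smul, map_smul]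
      congr 1
      refine Lp.ext ?_
      filter_upwards [hJ.map_symPow _ h1, hJ'.map_symPow _ h1] with ω e1 e2
      rw [e1, e2]

theorem isMultipleIntegral_multipleIntegral :
    IsMultipleIntegral hW q (multipleIntegral hW q) := by
  rw [multipleIntegral, dif_pos (exists_isMultipleIntegral hW q)]
  exact (exists_isMultipleIntegral hW q).choose_spec

theorem IsMultipleIntegral.map_symPow_of_norm_eq {J} (hJ : IsMultipleIntegral hW q J)
    {φ : CanonicalSpace hW} {r : ℝ} (hr : 0 < r) (hφ : ‖φ‖ = r) :
    ∀ᵐ ω ∂P, J (symPow q φ) ω =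
      q.factorial * (r ^ q * hermitePoly q (r⁻¹ * wiener hW φ ω)) := by
  have h : φ = r • (r⁻¹ • φ) := by
    rw [smul_smul, mul_inv_cancel₀ hr.ne', one_smul]
  have h1 : ‖r⁻¹ • φ‖ = 1 := by
    rw [norm_smul, norm_inv, Real.norm_of_nonneg hr.le, hφ, inv_mul_cancel₀ hr.ne']
  have e : J (symPow q φ) = r ^ q • J (symPow q (r⁻¹ • φ)) := by
    conv_lhs => rw [h, symPow_smul, map_smul]
  rw [e]
  filter_upwards [hJ.map_symPow _ h1, Lp.coeFn_smul (r ^ q) (J (symPow q (r⁻¹ • φ))),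
    Lp.coeFn_smul r⁻¹ (wiener hW φ)] with ω h2 h3 h4
  rw [h3, Pi.smul_apply, h2, map_smul, h4, Pi.smul_apply, smul_eq_mul, smul_eq_mul]
  ring

end MultipleIntegral

end HermiteVariations

namespace HermiteVariations

/-! ### Covariance of the increments of the fractional Brownian motion -/

/-- Covariance of the increments over `[s, s']` and `[t, t']` of the fractional Brownian motion. -/
noncomputable def incrCov (γ s s' t t' : ℝ) : ℝ :=
  fbmCov γ s' t' - fbmCov γ s t' - fbmCov γ s' t + fbmCov γ s t

theorem incrCov_comm (γ s s' t t' : ℝ) : incrCov γ s s' t t' = incrCov γ t t' s s' := by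
  have h : ∀ x y, fbmCov γ x y = fbmCov γ y x := fun x y => by
    rw [fbmCov, fbmCov, abs_sub_comm, add_comm (x ^ _)]
  rw [incrCov, incrCov, h s' t', h s t', h s' t, h s t]
  ring

theorem incrCov_eq (γ s s' t t' : ℝ) : incrCov γ s s' t t' =
    (|s' - t| ^ (2 * γ) - |s' - t'| ^ (2 * γ)) / 2 - (|s - t| ^ (2 * γ) - |s - t'| ^ (2 * γ)) / 2 := by
  simp only [incrCov, fbmCov]
  ring

theorem abs_rpow_sub_two_mul_self {b : ℝ} (x : ℝ) (hx : 0 ≤ x) (hb : b ≠ 1) :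
    |x| ^ (b - 2) * x = x ^ (b - 1) := by
  rcases hx.eq_or_lt with rfl | hx
  · rw [mul_zero, Real.zero_rpow (sub_ne_zero.2 hb)]
  · rw [abs_of_pos hx, ← Real.rpow_add_one hx.ne']
    congr 1
    ring

/-- The function `|x|^{b-2} x`, the derivative of `|x|^b / b`, is Hölder of exponent `b - 1`. For
equal signs this is subadditivity of the power; for opposite signs each term is at most `|x -
y|^{b-1}`, whence the constant `2`. -/
theorem abs_signed_rpow_sub_le {b : ℝ} (hb : 1 < b) (hb2 : b ≤ 2) (x y : ℝ) :
    |(|x| ^ (b - 2) * x) - |y| ^ (b - 2) * y| ≤ 2 * |x - y| ^ (b - 1) := by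
  have hb0 : 0 ≤ b - 1 := by linarith
  have hb1 : b - 1 ≤ 1 := by linarith
  have hneg : ∀ x : ℝ, |(-x)| ^ (b - 2) * (-x) = -(|x| ^ (b - 2) * x) := fun x => by
    rw [abs_neg]; ring
  have same : ∀ x y : ℝ, 0 ≤ y → y ≤ x →
      |(|x| ^ (b - 2) * x) - |y| ^ (b - 2) * y| ≤ 2 * |x - y| ^ (b - 1) := by
    intro x y hy hxy
    rw [abs_rpow_sub_two_mul_self x (hy.trans hxy) hb.ne', abs_rpow_sub_two_mul_self y hy hb.ne',
      abs_of_nonneg (sub_nonneg.2 hxy),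
      abs_of_nonneg (sub_nonneg.2 (Real.rpow_le_rpow hy hxy hb0))]
    have h := Real.rpow_add_le_add_rpow (sub_nonneg.2 hxy) hy hb0 hb1
    rw [sub_add_cancel] at h
    have := Real.rpow_nonneg (sub_nonneg.2 hxy) (b - 1)
    linarith
  have opp : ∀ x y : ℝ, 0 ≤ x → y ≤ 0 →
      |(|x| ^ (b - 2) * x) - |y| ^ (b - 2) * y| ≤ 2 * |x - y| ^ (b - 1) := by
    intro x y hx hy
    have e : |y| ^ (b - 2) * y = -((-y) ^ (b - 1)) := by
      rw [← abs_rpow_sub_two_mul_self (-y) (by linarith) hb.ne', hneg, neg_neg]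
    rw [abs_rpow_sub_two_mul_self x hx hb.ne', e, sub_neg_eq_add,
      abs_of_nonneg (by have := Real.rpow_nonneg hx (b - 1)
                        have := Real.rpow_nonneg (neg_nonneg.2 hy) (b - 1)
                        linarith), abs_of_nonneg (by linarith : 0 ≤ x - y)]
    have h1 := Real.rpow_le_rpow hx (by linarith : x ≤ x - y) hb0
    have h2 := Real.rpow_le_rpow (neg_nonneg.2 hy) (by linarith : -y ≤ x - y) hb0
    linarith
  have pos : ∀ x y : ℝ, y ≤ x →
      |(|x| ^ (b - 2) * x) - |y| ^ (b - 2) * y| ≤ 2 * |x - y| ^ (b - 1) := by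
    intro x y hxy
    rcases le_total 0 y with hy | hy
    · exact same x y hy hxy
    rcases le_total 0 x with hx | hx
    · exact opp x y hx hy
    · have h := same (-y) (-x) (by linarith) (by linarith)
      rw [hneg, hneg] at h
      convert h using 2 <;> ring_nf
  rcases le_total y x with h | h
  · exact pos x y h
  · rw [abs_sub_comm, abs_sub_comm x y]
    exact pos y x h

/-- The mean value theorem in the first interval alone. It applies even to overlapping intervals,
since `|x|^{2γ}` is differentiable at `0` when `2γ > 1`. -/
theorem exists_incrCov_eq {γ : ℝ} (hγ : 1 / 2 < γ) {s h : ℝ} (hh : 0 < h) (t t' : ℝ) :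
    ∃ ξ ∈ Set.Ioo s (s + h), incrCov γ s (s + h) t t' =
      h * (γ * (|ξ - t| ^ (2 * γ - 2) * (ξ - t) - |ξ - t'| ^ (2 * γ - 2) * (ξ - t'))) := by
  have hd : ∀ c x : ℝ, HasDerivAt (fun x => |x - c| ^ (2 * γ))
      (2 * γ * |x - c| ^ (2 * γ - 2) * (x - c)) x := fun c x => by
    have h := (hasDerivAt_abs_rpow (x - c) (by linarith : 1 < 2 * γ)).comp x
      ((hasDerivAt_id x).sub_const c)
    rw [mul_one] at h
    exact h
  have hF := fun x => ((hd t x).sub (hd t' x)).div_const 2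
  obtain ⟨ξ, hξ, e⟩ := exists_hasDerivAt_eq_slope _ _ (by linarith : s < s + h)
    (fun x _ => (hF x).continuousAt.continuousWithinAt) (fun x _ => hF x)
  refine ⟨ξ, hξ, ?_⟩
  rw [incrCov_eq]
  rw [add_sub_cancel_left, eq_div_iff hh.ne'] at e
  simp only [Pi.sub_apply] at e
  rw [← e]
  ring

/-- A second mean value step. The separation hypothesis keeps the differences away from `0`, where
the second derivative is singular. -/
theorem exists_incrCov_eq_of_lt {γ : ℝ} (hγ : 1 / 2 < γ) {s h t h' : ℝ} (hh : 0 < h) (hh' : 0 < h')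
    (h0 : 0 < s - t - h' ∨ s - t + h < 0) :
    ∃ η ∈ Set.Ioo (s - t - h') (s - t + h), incrCov γ s (s + h) t (t + h') =
      h * h' * (γ * (2 * γ - 1) * |η| ^ (2 * γ - 2)) := by
  obtain ⟨ξ, hξ, e⟩ := exists_incrCov_eq hγ hh t (t + h') (s := s)
  have hd : ∀ x ∈ Set.Icc (ξ - (t + h')) (ξ - t), HasDerivAt (fun x => |x| ^ (2 * γ - 2) * x)
      ((2 * γ - 1) * |x| ^ (2 * γ - 2)) x := by
    intro x hx
    have hx0 : x ≠ 0 := by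
      rintro rfl
      rcases h0 with h0 | h0 <;> linarith [hξ.1, hξ.2, hx.1, hx.2]
    have h1 := ((hasDerivAt_abs hx0).rpow_const (p := 2 * γ - 2)
      (Or.inl (abs_ne_zero.2 hx0))).mul (hasDerivAt_id x)
    refine h1.congr_deriv ?_
    have e1 : |x| ^ (2 * γ - 2) = |x| ^ (2 * γ - 2 - 1) * |x| := by
      rw [← Real.rpow_add_one (abs_ne_zero.2 hx0)]
      congr 1
      ring
    have e2 : (SignType.sign x : ℝ) * x = |x| := by
      rcases lt_or_gt_of_ne hx0 with h | h
      · simp [sign_neg h, abs_of_neg h]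
      · simp [sign_pos h, abs_of_pos h]
    simp only [id]
    rw [e1]
    linear_combination ((2 * γ - 2) * |x| ^ (2 * γ - 2 - 1)) * e2
  obtain ⟨η, hη, e'⟩ := exists_hasDerivAt_eq_slope _ _
    (by linarith : ξ - (t + h') < ξ - t)
    (fun x hx => (hd x hx).continuousAt.continuousWithinAt)
    (fun x hx => hd x (Set.Ioo_subset_Icc_self hx))
  refine ⟨η, ⟨by linarith [hξ.1, hη.1], by linarith [hξ.2, hη.2]⟩, ?_⟩
  rw [show ξ - t - (ξ - (t + h')) = h' by ring, eq_div_iff hh'.ne'] at e'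
  rw [e, ← e']
  ring

theorem rpow_le_mul_of_le {r C x y : ℝ} (hr : -1 ≤ r) (hr0 : r ≤ 0) (hC : 1 ≤ C) (hx : 0 < x)
    (hxy : x ≤ C * y) : y ^ r ≤ C * x ^ r := by
  have hC0 : 0 < C := by linarith
  have hy : x / C ≤ y := by rwa [div_le_iff₀' hC0]
  have h1 := Real.rpow_le_rpow_of_nonpos (div_pos hx hC0) hy hr0
  refine h1.trans ?_
  rw [Real.div_rpow hx.le hC0.le, div_eq_mul_inv, ← Real.rpow_neg hC0.le, mul_comm]
  refine mul_le_mul_of_nonneg_right ?_ (Real.rpow_nonneg hx.le _)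
  conv_rhs => rw [← Real.rpow_one C]
  exact Real.rpow_le_rpow_of_exponent_le hC (by linarith)

/-- This bound, uniform in both meshes, yields the dominating function. Near the diagonal one mean
value step and the Hölder bound suffice; away from it the second-order formula applies. -/
theorem abs_incrCov_le {γ : ℝ} (hγ : 1 / 2 < γ) (hγ1 : γ ≤ 1) {s h t h' u v : ℝ} (hh : 0 < h)
    (hh' : 0 < h') (hu : u ∈ Set.Ico s (s + h)) (hv : v ∈ Set.Ico t (t + h')) (huv : u ≠ v) :
    |incrCov γ s (s + h) t (t + h')| ≤ h * h' * (8 * |u - v| ^ (2 * γ - 2)) := by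
  wlog hle : h ≤ h' generalizing s h t h' u v
  · have := this hh' hh hv hu huv.symm (le_of_not_ge hle)
    rw [incrCov_comm, abs_sub_comm, mul_comm h]
    exact this
  have huv0 : 0 < |u - v| := abs_pos.2 (sub_ne_zero.2 huv)
  -- The threshold is set by the larger mesh `h'`. Below it `h'^{2γ-2} ≤ 4 |u - v|^{2γ-2}`. Above it
  -- the point `η` is within `2 h' < |u - v| / 2` of `u - v`, so `|u - v| ≤ 2 |η|`.
  rcases le_or_gt |u - v| (4 * h') with hc | hc
  · obtain ⟨ξ, -, e⟩ := exists_incrCov_eq hγ hh t (t + h') (s := s)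
    have h1 := abs_signed_rpow_sub_le (b := 2 * γ) (by linarith) (by linarith) (ξ - t)
      (ξ - (t + h'))
    rw [show ξ - t - (ξ - (t + h')) = h' by ring, abs_of_pos hh'] at h1
    have h2 : h' ^ (2 * γ - 1) = h' * h' ^ (2 * γ - 2) := by
      rw [mul_comm h', ← Real.rpow_add_one hh'.ne']
      congr 1
      ring
    have h3 := rpow_le_mul_of_le (r := 2 * γ - 2) (by linarith) (by linarith) (by norm_num) huv0 hc
    rw [e, abs_mul, abs_of_pos hh, abs_mul, abs_of_pos (by linarith : 0 < γ), mul_assoc]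
    refine mul_le_mul_of_nonneg_left ?_ hh.le
    have h4 : γ * (2 * h' ^ (2 * γ - 1)) ≤ 1 * (2 * h' ^ (2 * γ - 1)) := by
      gcongr
    calc γ * _ ≤ γ * (2 * h' ^ (2 * γ - 1)) := by gcongr
      _ ≤ 1 * (2 * h' ^ (2 * γ - 1)) := h4
      _ = h' * (2 * h' ^ (2 * γ - 2)) := by rw [h2]; ring
      _ ≤ h' * (2 * (4 * |u - v| ^ (2 * γ - 2))) := by gcongr
      _ = _ := by ring
  · have h0 : 0 < s - t - h' ∨ s - t + h < 0 := by
      rcases lt_abs.1 hc with h1 | h1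
      · left; linarith [hu.2, hv.1]
      · right; linarith [hu.1, hv.2]
    obtain ⟨η, hη, e⟩ := exists_incrCov_eq_of_lt hγ hh hh' h0
    have h1 : |u - v| ≤ 2 * |η| := by
      have h2 : |(u - v) - η| ≤ 2 * h' := by
        rw [abs_le]
        constructor <;> linarith [hη.1, hη.2, hu.1, hu.2, hv.1, hv.2]
      have h3 := abs_sub_abs_le_abs_sub (u - v) η
      linarith
    have h3 := rpow_le_mul_of_le (r := 2 * γ - 2) (by linarith) (by linarith) (by norm_num) huv0 h1
    have hn : 0 ≤ |η| ^ (2 * γ - 2) := Real.rpow_nonneg (abs_nonneg _) _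
    have hn' : 0 ≤ |u - v| ^ (2 * γ - 2) := Real.rpow_nonneg (abs_nonneg _) _
    have hc0 : 0 ≤ γ * (2 * γ - 1) := mul_nonneg (by linarith) (by linarith)
    have hc1 : γ * (2 * γ - 1) ≤ 1 := mul_le_one₀ hγ1 (by linarith) (by linarith)
    rw [e, abs_of_nonneg (by positivity)]
    refine mul_le_mul_of_nonneg_left ?_ (by positivity)
    calc _ ≤ 1 * |η| ^ (2 * γ - 2) := by gcongr
      _ ≤ 8 * |u - v| ^ (2 * γ - 2) := by linarith

/-! ### Grid covariances and their pointwise limit -/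

/-- Covariance of the `i`-th and `j`-th increments on the grids of mesh `1/N` and `1/N'`. -/
noncomputable def gridCov (γ : ℝ) (N N' i j : ℕ) : ℝ :=
  incrCov γ (i / N) (((i + 1 : ℕ) : ℝ) / N) (j / N') (((j + 1 : ℕ) : ℝ) / N')

theorem gridCov_eq (γ : ℝ) (N N' i j : ℕ) : gridCov γ N N' i j =
    incrCov γ (i / N) (i / N + 1 / N) (j / N') (j / N' + 1 / N') := by
  rw [gridCov]
  push_cast
  rw [add_div, add_div]

theorem mem_gridCell {N : ℕ} (hN : 0 < N) {u : ℝ} (hu : 0 ≤ u) :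
    u ∈ Set.Ico ((⌊N * u⌋₊ : ℝ) / N) (⌊N * u⌋₊ / N + 1 / N) := by
  have hN' : (0 : ℝ) < N := by exact_mod_cast hN
  rw [← add_div]
  constructor
  · rw [div_le_iff₀' hN']
    exact Nat.floor_le (by positivity)
  · rw [lt_div_iff₀' hN']
    exact Nat.lt_floor_add_one _

theorem mem_gridCell_iff {N : ℕ} (hN : 0 < N) {u : ℝ} {i : ℕ} :
    u ∈ Set.Ico ((i : ℝ) / N) (i / N + 1 / N) ↔ 0 ≤ u ∧ i = ⌊N * u⌋₊ := by
  have hN' : (0 : ℝ) < N := by exact_mod_cast hN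
  refine ⟨fun h => ?_, fun ⟨h0, h⟩ => h ▸ mem_gridCell hN h0⟩
  have h0 : 0 ≤ u := le_trans (by positivity) h.1
  refine ⟨h0, ?_⟩
  rw [← add_div, Set.mem_Ico, div_le_iff₀' hN', lt_div_iff₀' hN'] at h
  exact ((Nat.floor_eq_iff (by positivity)).2 h).symm

theorem tendsto_one_div_add_one_div :
    Tendsto (fun p : ℕ × ℕ => 1 / (p.1 : ℝ) + 1 / (p.2 : ℝ)) atTop (𝓝 0) := by
  have h := tendsto_one_div_atTop_nhds_zero_nat (𝕜 := ℝ)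
  have hf : Tendsto (Prod.fst : ℕ × ℕ → ℕ) atTop atTop := by
    rw [← prod_atTop_atTop_eq]; exact tendsto_fst
  have hs : Tendsto (Prod.snd : ℕ × ℕ → ℕ) atTop atTop := by
    rw [← prod_atTop_atTop_eq]; exact tendsto_snd
  simpa using (h.comp hf).add (h.comp hs)

theorem eventually_pos_prod : ∀ᶠ p : ℕ × ℕ in atTop, 0 < p.1 ∧ 0 < p.2 := by
  filter_upwards [eventually_ge_atTop ((1, 1) : ℕ × ℕ)] with p hp
  exact ⟨hp.1, hp.2⟩

/-- Once the meshes add up to less than `|u - v|` the cells are separated, and the scaled covariance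
is the limiting function at a point within that sum of `u - v`. -/
theorem tendsto_gridCov {γ : ℝ} (hγ : 1 / 2 < γ) {u v : ℝ} (hu : 0 ≤ u) (hv : 0 ≤ v)
    (huv : u ≠ v) :
    Tendsto (fun p : ℕ × ℕ => (p.1 : ℝ) * p.2 * gridCov γ p.1 p.2 ⌊p.1 * u⌋₊ ⌊p.2 * v⌋₊) atTop
      (𝓝 (γ * (2 * γ - 1) * |u - v| ^ (2 * γ - 2))) := by
  have hne : u - v ≠ 0 := sub_ne_zero.2 huv
  have hcont : ContinuousAt (fun x : ℝ => γ * (2 * γ - 1) * |x| ^ (2 * γ - 2)) (u - v) :=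
    continuousAt_const.mul (continuous_abs.continuousAt.rpow_const (Or.inl (abs_ne_zero.2 hne)))
  rw [Metric.tendsto_nhds]
  intro ε hε
  obtain ⟨δ, hδ, hδε⟩ := Metric.continuousAt_iff.1 hcont ε hε
  have hm : 0 < min δ |u - v| := lt_min hδ (abs_pos.2 hne)
  filter_upwards [tendsto_one_div_add_one_div.eventually_lt_const hm, eventually_pos_prod]
    with p hp ⟨hp1, hp2⟩
  have hu' := mem_gridCell hp1 hu
  have hv' := mem_gridCell hp2 hv
  have h1 : (0 : ℝ) < 1 / p.1 := by positivity
  have h2 : (0 : ℝ) < 1 / p.2 := by positivity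
  have hlt := lt_of_lt_of_le hp (min_le_left _ _)
  have hlt2 := lt_of_lt_of_le hp (min_le_right _ _)
  have h0 : (0 : ℝ) < ⌊p.1 * u⌋₊ / p.1 - ⌊p.2 * v⌋₊ / p.2 - 1 / p.2 ∨
      (⌊p.1 * u⌋₊ / p.1 - ⌊p.2 * v⌋₊ / p.2 + 1 / p.1 : ℝ) < 0 := by
    rcases lt_abs.1 hlt2 with h | h
    · left; linarith [hu'.2, hv'.1]
    · right; linarith [hu'.1, hv'.2]
  obtain ⟨η, hη, e⟩ := exists_incrCov_eq_of_lt hγ h1 h2 h0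
  have e2 : (p.1 : ℝ) * p.2 * gridCov γ p.1 p.2 ⌊p.1 * u⌋₊ ⌊p.2 * v⌋₊ =
      γ * (2 * γ - 1) * |η| ^ (2 * γ - 2) := by
    rw [gridCov_eq, e]
    field_simp
  rw [e2]
  refine hδε ?_
  rw [Real.dist_eq, abs_lt]
  constructor <;> linarith [hη.1, hη.2, hu'.1, hu'.2, hv'.1, hv'.2]

/-! ### Double sums as integrals, and dominated convergence -/

/-- The step function whose integral is the scalar product of two kernels in one variable. -/
noncomputable def kernelStep (γ : ℝ) (q : ℕ) (a : ℕ → ℕ) (p : ℕ × ℕ) (z : ℝ × ℝ) : ℝ :=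
  ∑ i ∈ Finset.range (a p.1), ∑ j ∈ Finset.range (a p.2),
    (Set.Ico ((i : ℝ) / p.1) (i / p.1 + 1 / p.1) ×ˢ
      Set.Ico ((j : ℝ) / p.2) (j / p.2 + 1 / p.2)).indicator
      (fun _ => ((p.1 : ℝ) * p.2 * gridCov γ p.1 p.2 i j) ^ q) z

theorem kernelStep_eq (γ : ℝ) (q : ℕ) (a : ℕ → ℕ) {p : ℕ × ℕ} (hp : 0 < p.1 ∧ 0 < p.2)
    (z : ℝ × ℝ) : kernelStep γ q a p z =
      if (0 ≤ z.1 ∧ ⌊p.1 * z.1⌋₊ < a p.1) ∧ (0 ≤ z.2 ∧ ⌊p.2 * z.2⌋₊ < a p.2) then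
        ((p.1 : ℝ) * p.2 * gridCov γ p.1 p.2 ⌊p.1 * z.1⌋₊ ⌊p.2 * z.2⌋₊) ^ q else 0 := by
  classical
  have e : ∀ i j : ℕ, (Set.Ico ((i : ℝ) / p.1) (i / p.1 + 1 / p.1) ×ˢ
      Set.Ico ((j : ℝ) / p.2) (j / p.2 + 1 / p.2)).indicator
      (fun _ => ((p.1 : ℝ) * p.2 * gridCov γ p.1 p.2 i j) ^ q) z =
      if i = ⌊p.1 * z.1⌋₊ then if j = ⌊p.2 * z.2⌋₊ then if 0 ≤ z.1 ∧ 0 ≤ z.2 then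
        ((p.1 : ℝ) * p.2 * gridCov γ p.1 p.2 i j) ^ q else 0 else 0 else 0 := by
    intro i j
    simp only [Set.indicator, Set.mem_prod, mem_gridCell_iff hp.1, mem_gridCell_iff hp.2]
    split_ifs <;> tauto
  simp only [kernelStep, e]
  simp only [Finset.sum_ite_irrel, Finset.sum_const_zero, Finset.sum_ite_eq', Finset.mem_range]
  split_ifs <;> tauto

theorem integral_kernelStep (γ : ℝ) (q : ℕ) (hq : 1 ≤ q) (a : ℕ → ℕ) {p : ℕ × ℕ}
    (hp : 0 < p.1 ∧ 0 < p.2) : ∫ z, kernelStep γ q a p z =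
      ((p.1 : ℝ) * p.2) ^ (q - 1) * ∑ i ∈ Finset.range (a p.1), ∑ j ∈ Finset.range (a p.2),
        gridCov γ p.1 p.2 i j ^ q := by
  have hp1 : (0 : ℝ) < p.1 := by exact_mod_cast hp.1
  have hp2 : (0 : ℝ) < p.2 := by exact_mod_cast hp.2
  have hvol : ∀ i j : ℕ, volume (Set.Ico ((i : ℝ) / p.1) (i / p.1 + 1 / p.1) ×ˢ
      Set.Ico ((j : ℝ) / p.2) (j / p.2 + 1 / p.2)) =
      ENNReal.ofReal (1 / p.1) * ENNReal.ofReal (1 / p.2) := by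
    intro i j
    rw [Measure.volume_eq_prod, Measure.prod_prod, Real.volume_Ico, Real.volume_Ico]
    simp
  have hmeas : ∀ i j : ℕ, MeasurableSet (Set.Ico ((i : ℝ) / p.1) (i / p.1 + 1 / p.1) ×ˢ
      Set.Ico ((j : ℝ) / p.2) (j / p.2 + 1 / p.2)) := fun i j =>
    measurableSet_Ico.prod measurableSet_Ico
  have hint : ∀ (i j : ℕ) (c : ℝ), Integrable ((Set.Ico ((i : ℝ) / p.1) (i / p.1 + 1 / p.1) ×ˢ
      Set.Ico ((j : ℝ) / p.2) (j / p.2 + 1 / p.2)).indicator fun _ => c) := by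
    intro i j c
    rw [integrable_indicator_iff (hmeas i j)]
    refine integrableOn_const ?_
    rw [hvol]
    exact ENNReal.mul_ne_top ENNReal.ofReal_ne_top ENNReal.ofReal_ne_top
  simp only [kernelStep]
  rw [integral_finsetSum _ fun i _ => integrable_finsetSum _ fun j _ => hint i j _, Finset.mul_sum]
  refine Finset.sum_congr rfl fun i _ => ?_
  rw [integral_finsetSum _ fun j _ => hint i j _, Finset.mul_sum]
  refine Finset.sum_congr rfl fun j _ => ?_
  rw [integral_indicator (hmeas i j), setIntegral_const, Measure.real, hvol, ENNReal.toReal_mul,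
    ENNReal.toReal_ofReal (by positivity), ENNReal.toReal_ofReal (by positivity)]
  -- The area of a rectangle absorbs one of the `q` factors `p.1 * p.2`.
  obtain ⟨k, rfl⟩ : ∃ k, q = k + 1 := ⟨q - 1, by omega⟩
  simp only [Nat.add_sub_cancel, smul_eq_mul, pow_succ, mul_pow]
  field_simp

/-- The shear `(u, v) ↦ (u - v, v)` preserves measure and turns the function into a product of
integrable functions of one variable. -/
theorem integrable_dominating {r : ℝ} (hr : -1 < r) :
    Integrable fun z : ℝ × ℝ => (Set.Icc (-1 : ℝ) 1).indicator (fun w => |w| ^ r) (z.1 - z.2) *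
      (Set.Icc (0 : ℝ) 1).indicator (fun _ => (1 : ℝ)) z.2 := by
  have h1 : Integrable ((Set.Icc (-1 : ℝ) 1).indicator fun w => |w| ^ r) := by
    rw [integrable_indicator_iff measurableSet_Icc]
    have hp : IntegrableOn (fun w : ℝ => |w| ^ r) (Set.Icc 0 1) := by
      have h := (intervalIntegral.intervalIntegrable_rpow' (a := 0) (b := 1) hr)
      rw [intervalIntegrable_iff_integrableOn_Icc_of_le zero_le_one] at h
      refine h.congr_fun (fun w hw => ?_) measurableSet_Icc
      simp only [abs_of_nonneg hw.1]
    have hn : IntegrableOn (fun w : ℝ => |w| ^ r) (Set.Icc (-1) 0) := by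
      have h := hp.comp_neg
      simpa using h
    have := hn.union hp
    rwa [Set.Icc_union_Icc_eq_Icc (by norm_num) (by norm_num)] at this
  have h2 : Integrable ((Set.Icc (0 : ℝ) 1).indicator fun _ => (1 : ℝ)) := by
    rw [integrable_indicator_iff measurableSet_Icc]
    exact integrableOn_const (by simp)
  have h3 := h1.mul_prod h2
  exact (measurePreserving_sub_prod (volume : Measure ℝ)
    (volume : Measure ℝ)).integrable_comp_of_integrable h3

/-- The discarded lines are the diagonal, where the limit is singular, and the edges at `t`, where
membership in the summation range need not stabilize. -/
theorem ae_prod_ne (t : ℝ) :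
    ∀ᵐ z : ℝ × ℝ, z.1 ≠ z.2 ∧ z.1 ≠ t ∧ z.2 ≠ t := by
  have h0 : ∀ c : ℝ, ∀ᵐ x : ℝ, x ≠ c := fun c => by
    simp [ae_iff]
  have hf : Measure.QuasiMeasurePreserving (Prod.fst : ℝ × ℝ → ℝ) volume volume :=
    Measure.quasiMeasurePreserving_fst
  have hs : Measure.QuasiMeasurePreserving (Prod.snd : ℝ × ℝ → ℝ) volume volume :=
    Measure.quasiMeasurePreserving_snd
  have hd := hf.comp (measurePreserving_sub_prod (volume : Measure ℝ)
    (volume : Measure ℝ)).quasiMeasurePreserving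
  filter_upwards [hd.ae (h0 0), hf.ae (h0 t), hs.ae (h0 t)] with z h1 h2 h3
  exact ⟨sub_ne_zero.1 h1, h2, h3⟩

theorem tendsto_gridIndex_div (t : ℝ) (ht : 0 ≤ t) :
    Tendsto (fun N : ℕ => ((⌊((N : ℝ) - 1) * t⌋₊ : ℝ)) / N) atTop (𝓝 t) := by
  have h1 : Tendsto (fun N : ℕ => t - (t + 1) * (1 / (N : ℝ))) atTop (𝓝 t) := by
    simpa using (tendsto_const_nhds (x := t)).sub
      ((tendsto_one_div_atTop_nhds_zero_nat (𝕜 := ℝ)).const_mul (t + 1))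
  refine tendsto_of_tendsto_of_tendsto_of_le_of_le' h1 tendsto_const_nhds ?_ ?_
  · filter_upwards [eventually_gt_atTop 0] with N hN
    have hN' : (0 : ℝ) < N := by exact_mod_cast hN
    rw [le_div_iff₀ hN']
    have := Nat.lt_floor_add_one (((N : ℝ) - 1) * t)
    have e : (t - (t + 1) * (1 / (N : ℝ))) * N = t * N - (t + 1) := by field_simp
    rw [e]
    linarith
  · filter_upwards [eventually_gt_atTop 0] with N hN
    have hN' : (1 : ℝ) ≤ N := by exact_mod_cast hN
    rw [div_le_iff₀ (by linarith)]
    have := Nat.floor_le (mul_nonneg (sub_nonneg.2 hN') ht)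
    linarith

theorem eventually_floor_lt_iff {t u : ℝ} (ht : 0 ≤ t) (hu : 0 ≤ u) (hut : u ≠ t) :
    ∀ᶠ N : ℕ in atTop, ⌊N * u⌋₊ < ⌊((N : ℝ) - 1) * t⌋₊ + 1 ↔ u < t := by
  have h1 := tendsto_gridIndex_div t ht
  have h2 : Tendsto (fun N : ℕ => (⌊N * u⌋₊ : ℝ) / N) atTop (𝓝 u) := by
    have := (tendsto_nat_floor_mul_div_atTop hu).comp (tendsto_natCast_atTop_atTop (R := ℝ))
    refine this.congr fun N => ?_
    simp [mul_comm]
  rcases lt_or_gt_of_ne hut with h | h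
  · filter_upwards [h2.eventually_lt h1 h, eventually_gt_atTop 0] with N hN hN0
    have hN' : (0 : ℝ) < N := by exact_mod_cast hN0
    rw [div_lt_div_iff_of_pos_right hN'] at hN
    have : ⌊N * u⌋₊ < ⌊((N : ℝ) - 1) * t⌋₊ := by exact_mod_cast hN
    simp only [h, iff_true]
    omega
  · filter_upwards [h1.eventually_lt h2 h, eventually_gt_atTop 0] with N hN hN0
    have hN' : (0 : ℝ) < N := by exact_mod_cast hN0
    rw [div_lt_div_iff_of_pos_right hN'] at hN
    have : ⌊((N : ℝ) - 1) * t⌋₊ < ⌊N * u⌋₊ := by exact_mod_cast hN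
    simp only [h.not_gt, iff_false]
    omega

/-- Kernel indices never leave the grid, so the clamping in `gridPoint` does not act. -/
theorem gridIndex_le {N : ℕ} (hN : 0 < N) {t : ℝ} (ht1 : t ≤ 1) :
    ⌊((N : ℝ) - 1) * t⌋₊ + 1 ≤ N := by
  have hN' : (1 : ℝ) ≤ N := by exact_mod_cast hN
  have h : ⌊((N : ℝ) - 1) * t⌋₊ ≤ N - 1 := by
    refine Nat.floor_le_of_le ?_
    rw [Nat.cast_sub hN, Nat.cast_one]
    nlinarith
  omega

theorem exists_tendsto_sum_gridCov {γ : ℝ} {q : ℕ} (hq : 1 ≤ q)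
    (hγ : 1 - 1 / (2 * (q : ℝ)) < γ) (hγ1 : γ < 1) {t : ℝ} (ht : 0 ≤ t) (ht1 : t ≤ 1) :
    ∃ L : ℝ, Tendsto (fun p : ℕ × ℕ => ((p.1 : ℝ) * p.2) ^ (q - 1) *
      ∑ i ∈ Finset.range (⌊((p.1 : ℝ) - 1) * t⌋₊ + 1),
        ∑ j ∈ Finset.range (⌊((p.2 : ℝ) - 1) * t⌋₊ + 1), gridCov γ p.1 p.2 i j ^ q)
      atTop (𝓝 L) := by
  have hq' : (1 : ℝ) ≤ q := by exact_mod_cast hq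
  have hγ2 : 1 / 2 < γ := by
    have : 1 / (2 * (q : ℝ)) ≤ 1 / 2 := by
      gcongr; linarith
    linarith
  -- Equivalent to `γ > 1 - 1/(2q)`: the non-central regime is that of integrability at the
  -- diagonal.
  have hr : -1 < (2 * γ - 2) * q := by
    have h : 1 / (2 * (q : ℝ)) * (2 * q) = 1 := by field_simp
    nlinarith
  set a : ℕ → ℕ := fun N => ⌊((N : ℝ) - 1) * t⌋₊ + 1 with ha
  set f : ℝ × ℝ → ℝ := fun z => if (0 ≤ z.1 ∧ z.1 < t) ∧ (0 ≤ z.2 ∧ z.2 < t) then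
    (γ * (2 * γ - 1) * |z.1 - z.2| ^ (2 * γ - 2)) ^ q else 0 with hf
  refine ⟨∫ z, f z, ?_⟩
  have key : Tendsto (fun p : ℕ × ℕ => ∫ z, kernelStep γ q a p z) atTop (𝓝 (∫ z, f z)) := by
    refine tendsto_integral_filter_of_dominated_convergence _ ?_ ?_
      ((integrable_dominating hr).const_mul (8 ^ q)) ?_
    · refine Eventually.of_forall fun p => Measurable.aestronglyMeasurable ?_
      refine Finset.measurable_sum _ fun i _ => Finset.measurable_sum _ fun j _ => ?_
      exact measurable_const.indicator (measurableSet_Ico.prod measurableSet_Ico)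
    · filter_upwards [eventually_pos_prod] with p hp
      filter_upwards [ae_prod_ne t] with z hz
      rw [kernelStep_eq γ q a hp]
      have hp1 : (0 : ℝ) < p.1 := by exact_mod_cast hp.1
      have hp2 : (0 : ℝ) < p.2 := by exact_mod_cast hp.2
      split_ifs with h
      · obtain ⟨⟨h1, h2⟩, h3, h4⟩ := h
        have lt_one : ∀ {N : ℕ} {x : ℝ}, 0 < N → ⌊N * x⌋₊ < a N → x < 1 := by
          intro N x hN hx
          have hN' : (0 : ℝ) < N := by exact_mod_cast hN
          have h5 : ⌊N * x⌋₊ < N := hx.trans_le (gridIndex_le hN ht1)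
          have h6 : ((⌊N * x⌋₊ + 1 : ℕ) : ℝ) ≤ N := by exact_mod_cast h5
          have h7 := Nat.lt_floor_add_one ((N : ℝ) * x)
          push_cast at h6
          nlinarith
        have hu1 := lt_one hp.1 h2
        have hv1 := lt_one hp.2 h4
        have i1 : z.1 - z.2 ∈ Set.Icc (-1 : ℝ) 1 := ⟨by linarith, by linarith⟩
        have i2 : z.2 ∈ Set.Icc (0 : ℝ) 1 := ⟨h3, hv1.le⟩
        rw [Set.indicator_of_mem i1, Set.indicator_of_mem i2, mul_one, norm_pow, Real.norm_eq_abs,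
          Real.rpow_mul (abs_nonneg _), Real.rpow_natCast, ← mul_pow]
        refine pow_le_pow_left₀ (abs_nonneg _) ?_ q
        rw [abs_mul, abs_of_pos (by positivity : (0 : ℝ) < p.1 * p.2), gridCov_eq]
        have hb := abs_incrCov_le hγ2 hγ1.le (h := 1 / p.1) (h' := 1 / p.2) (by positivity)
          (by positivity) (mem_gridCell hp.1 h1) (mem_gridCell hp.2 h3) hz.1
        calc _ ≤ (p.1 : ℝ) * p.2 * (1 / p.1 * (1 / p.2) * (8 * |z.1 - z.2| ^ (2 * γ - 2))) := by
              gcongr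
          _ = _ := by field_simp
      · rw [norm_zero]
        refine mul_nonneg (by positivity) (mul_nonneg ?_ ?_)
        · exact Set.indicator_nonneg (fun w _ => Real.rpow_nonneg (abs_nonneg _) _) _
        · exact Set.indicator_nonneg (fun w _ => zero_le_one) _
    · filter_upwards [ae_prod_ne t] with z hz
      have hfst : Tendsto (Prod.fst : ℕ × ℕ → ℕ) atTop atTop := by
        rw [← prod_atTop_atTop_eq]; exact tendsto_fst
      have hsnd : Tendsto (Prod.snd : ℕ × ℕ → ℕ) atTop atTop := by
        rw [← prod_atTop_atTop_eq]; exact tendsto_snd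
      by_cases h0 : 0 ≤ z.1 ∧ 0 ≤ z.2
      · have e : ∀ᶠ p : ℕ × ℕ in atTop,
            (if (0 ≤ z.1 ∧ z.1 < t) ∧ (0 ≤ z.2 ∧ z.2 < t) then
            ((p.1 : ℝ) * p.2 * gridCov γ p.1 p.2 ⌊p.1 * z.1⌋₊ ⌊p.2 * z.2⌋₊) ^ q else 0) =
              kernelStep γ q a p z := by
          filter_upwards [eventually_pos_prod,
            hfst.eventually (eventually_floor_lt_iff ht h0.1 hz.2.1),
            hsnd.eventually (eventually_floor_lt_iff ht h0.2 hz.2.2)] with p hp h1 h2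
          rw [kernelStep_eq γ q a hp]
          simp only [ha, h1, h2]
        refine Tendsto.congr' e ?_
        simp only [hf]
        split_ifs
        · exact (tendsto_gridCov hγ2 h0.1 h0.2 hz.1).pow q
        · exact tendsto_const_nhds
      · have hz0 : f z = 0 := by
          simp only [hf]
          rw [if_neg]
          tauto
        rw [hz0]
        refine Tendsto.congr' ?_ tendsto_const_nhds
        filter_upwards [eventually_pos_prod] with p hp
        rw [kernelStep_eq γ q a hp, if_neg]
        tauto
  refine key.congr' ?_
  filter_upwards [eventually_pos_prod] with p hp
  rw [integral_kernelStep γ q hq a hp]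

end HermiteVariations

namespace HermiteVariations

/-! ### Scalar products and integrals of grid cells -/

section Cells

variable {Ω : Type*} [MeasurableSpace Ω] {α β : ℝ} {W : I × I → Ω → ℝ} {P : Measure Ω}
variable (hW : IsFractionalBrownianSheet α β W P)

theorem coe_gridPoint {N i : ℕ} (hN : 0 < N) (hi : i ≤ N) : (gridPoint N i : ℝ) = i / N := by
  have hN' : (0 : ℝ) < N := by exact_mod_cast hN
  have hi' : (i : ℝ) ≤ N := by exact_mod_cast hi
  rw [gridPoint, Set.projIcc_of_mem zero_le_one ⟨by positivity, (div_le_one hN').2 hi'⟩]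

theorem StepSpace.integral_single (p : I × I) :
    StepSpace.integral hW (StepSpace.of hW (.single p 1)) = (hW.memLp p).toLp (W p) := by
  simp [StepSpace.integral]

theorem StepSpace.inner_single (p r : I × I) :
    ⟪StepSpace.of hW (.single p 1), StepSpace.of hW (.single r 1)⟫ = sheetCov α β p r := by
  change StepSpace.form hW _ _ = _
  simp [StepSpace.form]

theorem StepSpace.inner_rectStep (s s' t t' a a' b b' : I) :
    ⟪StepSpace.of hW (rectStep s s' t t'), StepSpace.of hW (rectStep a a' b b')⟫ =
      incrCov α s s' a a' * incrCov β t t' b b' := by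
  simp only [rectStep, map_add, map_sub, inner_add_left, inner_sub_left, inner_add_right,
    inner_sub_right, inner_single, sheetCov, incrCov]
  ring

theorem inner_cell {N M N' M' i j i' j' : ℕ} (hi : i < N) (hj : j < M) (hi' : i' < N')
    (hj' : j' < M') : ⟪cell hW N M i j, cell hW N' M' i' j'⟫ =
      gridCov α N N' i i' * gridCov β M M' j j' := by
  rw [cell, cell, UniformSpace.Completion.inner_coe, StepSpace.inner_rectStep]
  rw [coe_gridPoint (by omega) hi.le, coe_gridPoint (by omega) (Nat.succ_le_of_lt hi),
    coe_gridPoint (by omega) hj.le, coe_gridPoint (by omega) (Nat.succ_le_of_lt hj),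
    coe_gridPoint (by omega) hi'.le, coe_gridPoint (by omega) (Nat.succ_le_of_lt hi'),
    coe_gridPoint (by omega) hj'.le, coe_gridPoint (by omega) (Nat.succ_le_of_lt hj')]
  rfl

theorem gridCov_self {γ : ℝ} (hγ : 0 < γ) {N : ℕ} (hN : 0 < N) (i : ℕ) :
    gridCov γ N N i i = ((N : ℝ) ^ (-γ)) ^ 2 := by
  have hN' : (0 : ℝ) < N := by exact_mod_cast hN
  have h0 : (0 : ℝ) ^ (2 * γ) = 0 := Real.zero_rpow (by positivity)
  rw [gridCov_eq, incrCov_eq]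
  simp only [add_sub_cancel_left, sub_self, sub_add_cancel_left, abs_neg, abs_zero, h0]
  rw [abs_of_pos (by positivity), ← Real.rpow_natCast, ← Real.rpow_mul hN'.le, one_div,
    Real.inv_rpow hN'.le, ← Real.rpow_neg hN'.le]
  rw [show -γ * ((2 : ℕ) : ℝ) = -(2 * γ) by push_cast; ring]
  ring

theorem norm_cell (hα : 0 < α) (hβ : 0 < β) {N M i j : ℕ} (hi : i < N) (hj : j < M) :
    ‖cell hW N M i j‖ = (N : ℝ) ^ (-α) * (M : ℝ) ^ (-β) := by
  have h := inner_cell hW hi hj hi hj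
  rw [real_inner_self_eq_norm_sq, gridCov_self hα (by omega), gridCov_self hβ (by omega),
    ← mul_pow] at h
  exact (sq_eq_sq₀ (norm_nonneg _) (by positivity)).1 h

theorem wiener_cell (N M i j : ℕ) : ∀ᵐ ω ∂P, wiener hW (cell hW N M i j) ω =
    W (gridPoint N (i + 1), gridPoint M (j + 1)) ω - W (gridPoint N i, gridPoint M (j + 1)) ω
        - W (gridPoint N (i + 1), gridPoint M j) ω + W (gridPoint N i, gridPoint M j) ω := by
  rw [cell, wiener_coe]
  simp only [rectStep, map_add, map_sub, StepSpace.integral_single]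
  set X := fun p => (hW.memLp p).toLp (W p)
  have h : ∀ p, ∀ᵐ ω ∂P, X p ω = W p ω := fun p => (hW.memLp p).coeFn_toLp
  filter_upwards [Lp.coeFn_add (X (gridPoint N (i + 1), gridPoint M (j + 1))
      - X (gridPoint N i, gridPoint M (j + 1)) - X (gridPoint N (i + 1), gridPoint M j))
      (X (gridPoint N i, gridPoint M j)),
    Lp.coeFn_sub (X (gridPoint N (i + 1), gridPoint M (j + 1))
      - X (gridPoint N i, gridPoint M (j + 1))) (X (gridPoint N (i + 1), gridPoint M j)),
    Lp.coeFn_sub (X (gridPoint N (i + 1), gridPoint M (j + 1)))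
      (X (gridPoint N i, gridPoint M (j + 1))),
    h (gridPoint N (i + 1), gridPoint M (j + 1)), h (gridPoint N i, gridPoint M (j + 1)),
    h (gridPoint N (i + 1), gridPoint M j), h (gridPoint N i, gridPoint M j)]
    with ω h1 h2 h3 h4 h5 h6 h7
  rw [h1, Pi.add_apply, h2, Pi.sub_apply, h3, Pi.sub_apply, h4, h5, h6, h7]

end Cells

/-! ### Convergence of kernels and variations -/

section Convergence

variable {Ω : Type*} [MeasurableSpace Ω] {α β : ℝ} {W : I × I → Ω → ℝ} {P : Measure Ω}
variable (hW : IsFractionalBrownianSheet α β W P) (q : ℕ)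

/-- A cell has norm `N^{-α} M^{-β}`: its `q`-th power comes out of the integral, its inverse
rescales the increment inside `H_q`, and the factorials cancel. -/
theorem renormalizedVariation_eq (hα : 0 < α) (hβ : 0 < β) (N M : ℕ) :
    ∀ᵐ ω ∂P, renormalizedVariation hW q N M ω =
      normalization q α β N M * (N : ℝ) ^ (-(α * q)) * (M : ℝ) ^ (-(β * q)) *
        hermiteVariation α β W q N M ω := by
  set J := multipleIntegral hW q
  have hJ : IsMultipleIntegral hW q J := isMultipleIntegral_multipleIntegral hW q
  have hcell : ∀ᵐ ω ∂P, ∀ i ∈ Finset.range N, ∀ j ∈ Finset.range M,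
      J (symPow q (cell hW N M i j)) ω =
        q.factorial * ((N : ℝ) ^ (-(α * q)) * (M : ℝ) ^ (-(β * q)) *
          hermitePoly q ((N : ℝ) ^ α * (M : ℝ) ^ β *
            (W (gridPoint N (i + 1), gridPoint M (j + 1)) ω -
              W (gridPoint N i, gridPoint M (j + 1)) ω
              - W (gridPoint N (i + 1), gridPoint M j) ω + W (gridPoint N i, gridPoint M j) ω))) := by
    refine (Finset.eventually_all _).2 fun i hi => (Finset.eventually_all _).2 fun j hj => ?_
    rw [Finset.mem_range] at hi hj
    have hN : (0 : ℝ) < N := by exact_mod_cast (by omega : 0 < N)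
    have hM : (0 : ℝ) < M := by exact_mod_cast (by omega : 0 < M)
    have hpow : ∀ {x γ : ℝ}, 0 < x → (x ^ (-γ)) ^ q = x ^ (-(γ * q)) := fun {x γ} hx => by
      rw [← Real.rpow_natCast, ← Real.rpow_mul hx.le, neg_mul]
    filter_upwards [hJ.map_symPow_of_norm_eq hW q (by positivity) (norm_cell hW hα hβ hi hj),
      wiener_cell hW N M i j] with ω h1 h2
    rw [h1, h2, mul_pow, hpow hN, hpow hM, mul_inv, Real.rpow_neg hN.le α,
      Real.rpow_neg hM.le β, inv_inv, inv_inv]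
  rw [renormalizedVariation]
  have hrow : ∀ᵐ ω ∂P, ∀ i ∈ Finset.range N,
      (∑ j ∈ Finset.range M, J (symPow q (cell hW N M i j)) : Lp ℝ 2 P) ω =
        ∑ j ∈ Finset.range M, J (symPow q (cell hW N M i j)) ω := by
    refine (Finset.eventually_all _).2 fun i _ => ?_
    filter_upwards [Lp.coeFn_finsetSum (Finset.range M)
      fun j => J (symPow q (cell hW N M i j))] with ω hω
    rw [hω, Finset.sum_apply]
  filter_upwards [hcell, hrow, Lp.coeFn_smul (1 / (q.factorial : ℝ) * normalization q α β N M)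
      (∑ i ∈ Finset.range N, ∑ j ∈ Finset.range M, J (symPow q (cell hW N M i j))),
    Lp.coeFn_finsetSum (Finset.range N)
      fun i => ∑ j ∈ Finset.range M, J (symPow q (cell hW N M i j))] with ω h1 h2 h3 h4
  rw [h3, Pi.smul_apply, h4, Finset.sum_apply, Finset.sum_congr rfl h2,
    Finset.sum_congr rfl fun i hi => Finset.sum_congr rfl (h1 i hi), hermiteVariation, smul_eq_mul]
  simp only [Finset.mul_sum]
  refine Finset.sum_congr rfl fun i _ => Finset.sum_congr rfl fun j _ => ?_
  field_simp

theorem inner_kernel (t s : I) {N M N' M' : ℕ} (hN : 0 < N) (hM : 0 < M) (hN' : 0 < N')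
    (hM' : 0 < M') :
    ⟪kernel hW q t s N M, kernel hW q t s N' M'⟫ =
      (1 / (q.factorial : ℝ) * √(q.factorial / (kappa q α * kappa q β))) ^ 2 *
      ((((N : ℝ) * N') ^ (q - 1) * ∑ i ∈ Finset.range (⌊((N : ℝ) - 1) * t⌋₊ + 1),
          ∑ i' ∈ Finset.range (⌊((N' : ℝ) - 1) * t⌋₊ + 1), gridCov α N N' i i' ^ q) *
        (((M : ℝ) * M') ^ (q - 1) * ∑ j ∈ Finset.range (⌊((M : ℝ) - 1) * s⌋₊ + 1),
          ∑ j' ∈ Finset.range (⌊((M' : ℝ) - 1) * s⌋₊ + 1), gridCov β M M' j j' ^ q)) := by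
  have hsum : ⟪∑ i ∈ Finset.range (⌊((N : ℝ) - 1) * t⌋₊ + 1),
        ∑ j ∈ Finset.range (⌊((M : ℝ) - 1) * s⌋₊ + 1), symPow q (cell hW N M i j),
      ∑ i ∈ Finset.range (⌊((N' : ℝ) - 1) * t⌋₊ + 1),
        ∑ j ∈ Finset.range (⌊((M' : ℝ) - 1) * s⌋₊ + 1), symPow q (cell hW N' M' i j)⟫ =
      (∑ i ∈ Finset.range (⌊((N : ℝ) - 1) * t⌋₊ + 1),
          ∑ i' ∈ Finset.range (⌊((N' : ℝ) - 1) * t⌋₊ + 1), gridCov α N N' i i' ^ q) *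
        ∑ j ∈ Finset.range (⌊((M : ℝ) - 1) * s⌋₊ + 1),
          ∑ j' ∈ Finset.range (⌊((M' : ℝ) - 1) * s⌋₊ + 1), gridCov β M M' j j' ^ q := by
    rw [sum_inner, Finset.sum_mul]
    refine Finset.sum_congr rfl fun i hi => ?_
    rw [sum_inner, Finset.sum_mul_sum]
    refine Eq.trans ?_ Finset.sum_comm
    refine Finset.sum_congr rfl fun j hj => ?_
    rw [inner_sum]
    simp only [Finset.mul_sum]
    refine Finset.sum_congr rfl fun i' hi' => ?_
    rw [inner_sum]
    refine Finset.sum_congr rfl fun j' hj' => ?_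
    rw [Finset.mem_range] at hi hj hi' hj'
    rw [inner_symPow, inner_cell hW (hi.trans_le (gridIndex_le hN t.2.2))
      (hj.trans_le (gridIndex_le hM s.2.2)) (hi'.trans_le (gridIndex_le hN' t.2.2))
      (hj'.trans_le (gridIndex_le hM' s.2.2)), mul_pow]
  have hsmul : ∀ (a b : ℝ) (x y : symTensorPower (CanonicalSpace hW) q),
      ⟪a • x, b • y⟫ = a * (b * ⟪x, y⟫) := fun a b x y =>
    (real_inner_smul_left x (b • y) a).trans (congrArg (a * ·) (real_inner_smul_right x y b))
  rw [kernel, kernel, hsmul, hsum, normalization, normalization]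
  simp only [mul_pow]
  ring

/-- Expanding `‖f z - f w‖²` gives the limit `L - 2L + L = 0`; no candidate for the limit vector is
needed. -/
theorem cauchy_map_of_tendsto_inner {E ι : Type*} [NormedAddCommGroup E] [InnerProductSpace ℝ E]
    {l : Filter ι} [l.NeBot] {f : ι → E} {L : ℝ}
    (h : Tendsto (fun z : ι × ι => ⟪f z.1, f z.2⟫) (l ×ˢ l) (𝓝 L)) : Cauchy (l.map f) := by
  rw [cauchy_map_iff, Metric.uniformity_eq_comap_nhds_zero, tendsto_comap_iff]
  refine ⟨inferInstance, ?_⟩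
  have h1 : Tendsto (fun z : ι × ι => ⟪f z.1, f z.1⟫) (l ×ˢ l) (𝓝 L) :=
    h.comp (tendsto_fst.prodMk tendsto_fst)
  have h2 : Tendsto (fun z : ι × ι => ⟪f z.2, f z.2⟫) (l ×ˢ l) (𝓝 L) :=
    h.comp (tendsto_snd.prodMk tendsto_snd)
  have h3 := ((h1.sub (h.const_mul 2)).add h2).sqrt
  rw [show L - 2 * L + L = 0 by ring, Real.sqrt_zero] at h3
  refine h3.congr fun z => ?_
  rw [Function.comp_apply, dist_eq_norm, real_inner_self_eq_norm_sq, real_inner_self_eq_norm_sq,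
    ← norm_sub_sq_real, Real.sqrt_sq (norm_nonneg _)]

theorem tendsto_kernel (hq : 1 ≤ q) (hα : 1 - 1 / (2 * (q : ℝ)) < α) (hα1 : α < 1)
    (hβ : 1 - 1 / (2 * (q : ℝ)) < β) (hβ1 : β < 1) (t s : I) :
    Tendsto (fun p : ℕ × ℕ => kernel hW q t s p.1 p.2) atTop (𝓝 (limitKernel hW q t s)) := by
  have : CompleteSpace (symTensorPower (CanonicalSpace hW) q) :=
    (Submodule.isClosed_topologicalClosure _).completeSpace_coe
  obtain ⟨A, hA⟩ := exists_tendsto_sum_gridCov hq hα hα1 t.2.1 t.2.2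
  obtain ⟨B, hB⟩ := exists_tendsto_sum_gridCov hq hβ hβ1 s.2.1 s.2.2
  have hfst : Tendsto (Prod.fst : ℕ × ℕ → ℕ) atTop atTop := by
    rw [← prod_atTop_atTop_eq]; exact tendsto_fst
  have hsnd : Tendsto (Prod.snd : ℕ × ℕ → ℕ) atTop atTop := by
    rw [← prod_atTop_atTop_eq]; exact tendsto_snd
  -- The four indices are regrouped by coordinate: the factor in `α` sees `(N, N')`, the one in `β`
  -- sees `(M, M')`.
  have h1 : Tendsto (fun z : (ℕ × ℕ) × (ℕ × ℕ) => (z.1.1, z.2.1)) (atTop ×ˢ atTop) atTop := by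
    rw [← prod_atTop_atTop_eq (α := ℕ) (β := ℕ)]
    rw [← prod_atTop_atTop_eq] at hfst
    exact hfst.prodMap hfst
  have h2 : Tendsto (fun z : (ℕ × ℕ) × (ℕ × ℕ) => (z.1.2, z.2.2)) (atTop ×ˢ atTop) atTop := by
    rw [← prod_atTop_atTop_eq (α := ℕ) (β := ℕ)]
    rw [← prod_atTop_atTop_eq] at hsnd
    exact hsnd.prodMap hsnd
  have hlim := ((hA.comp h1).mul (hB.comp h2)).const_mul
    ((1 / (q.factorial : ℝ) * √(q.factorial / (kappa q α * kappa q β))) ^ 2)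
  -- `limUnder` is meaningful only once a limit exists, which completeness of the closed subspace
  -- supplies.
  refine tendsto_nhds_limUnder (cauchy_map_iff_exists_tendsto.1
    (cauchy_map_of_tendsto_inner (hlim.congr' ?_)))
  filter_upwards [eventually_pos_prod.prod_mk eventually_pos_prod] with z hz
  exact (inner_kernel hW q t s hz.1.1 hz.1.2 hz.2.1 hz.2.2).symm

/-- At `t = s = 1` the kernel runs over the full grid. For `N = 0` the truncated floor would still
leave one index, hence the positivity. -/
theorem renormalizedVariation_eq_multipleIntegral {N M : ℕ} (hN : 0 < N) (hM : 0 < M) :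
    renormalizedVariation hW q N M = multipleIntegral hW q (kernel hW q 1 1 N M) := by
  have h : ∀ {K : ℕ}, 0 < K → ⌊((K : ℝ) - 1) * ((1 : I) : ℝ)⌋₊ + 1 = K := by
    intro K hK
    obtain ⟨k, rfl⟩ : ∃ k, K = k + 1 := ⟨K - 1, by omega⟩
    simp
  rw [renormalizedVariation, kernel, h hN, h hM, map_smul, map_sum]
  simp only [map_sum]

theorem tendsto_integral_renormalizedVariation (hq : 1 ≤ q) (hα : 1 - 1 / (2 * (q : ℝ)) < α)
    (hα1 : α < 1) (hβ : 1 - 1 / (2 * (q : ℝ)) < β) (hβ1 : β < 1) :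
    Tendsto (fun p : ℕ × ℕ =>
      ∫ ω, |renormalizedVariation hW q p.1 p.2 ω - hermiteSheet hW q 1 1 ω| ^ 2 ∂P)
      atTop (𝓝 0) := by
  have h := ((multipleIntegral hW q).continuous.tendsto _).comp
    (tendsto_kernel hW q hq hα hα1 hβ hβ1 1 1)
  have h2 := (tendsto_iff_norm_sub_tendsto_zero.1 h).pow 2
  rw [zero_pow two_ne_zero] at h2
  refine h2.congr' ?_
  filter_upwards [eventually_pos_prod] with p hp
  rw [Function.comp_apply, ← renormalizedVariation_eq_multipleIntegral hW q hp.1 hp.2,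
    ← hermiteSheet, ← real_inner_self_eq_norm_sq, inner_Lp_eq_integral]
  refine integral_congr_ae ?_
  filter_upwards [Lp.coeFn_sub (renormalizedVariation hW q p.1 p.2) (hermiteSheet hW q 1 1)]
    with ω hω
  rw [hω, Pi.sub_apply, sq_abs, sq]

end Convergence

end HermiteVariations

open HermiteVariations in
theorem mainTheorem2 {Ω : Type*} [MeasurableSpace Ω] (P : Measure Ω) [IsProbabilityMeasure P]
    (q : ℕ) (hq : 2 ≤ q) (α β : ℝ)
    (hα : 1 - 1 / (2 * (q : ℝ)) < α) (hα1 : α < 1) (hβ : 1 - 1 / (2 * (q : ℝ)) < β) (hβ1 : β < 1)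
    (W : I × I → Ω → ℝ) (hW : IsFractionalBrownianSheet α β W P) :
    -- the multiple integral `I_q` exists and is unique
    (∃! J, IsMultipleIntegral hW q J) ∧
    -- the kernels converge in the tensor power of the canonical Hilbert space
    (∀ t s : I, Tendsto (fun p : ℕ × ℕ => kernel hW q t s p.1 p.2) atTop
      (𝓝 (limitKernel hW q t s))) ∧
    -- `Ṽ_{N,M}` is the renormalized Hermite variation
    (∀ N M : ℕ, 0 < N → 0 < M → ∀ᵐ ω ∂P, renormalizedVariation hW q N M ω =
      normalization q α β N M * (N : ℝ) ^ (-(α * q)) * (M : ℝ) ^ (-(β * q)) *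
        hermiteVariation α β W q N M ω) ∧
    -- convergence in `L²(Ω)` to the value of the Hermite sheet at `(1, 1)`
    Tendsto (fun p : ℕ × ℕ =>
      ∫ ω, |renormalizedVariation hW q p.1 p.2 ω - hermiteSheet hW q 1 1 ω| ^ 2 ∂P)
      atTop (𝓝 0) := by
  have hq' : (2 : ℝ) ≤ q := by exact_mod_cast hq
  have hlt : 1 / (2 * (q : ℝ)) < 1 := by
    rw [div_lt_one (by linarith)]
    linarith
  refine ⟨?_, tendsto_kernel hW q (by omega) hα hα1 hβ hβ1,
    fun N M _ _ => renormalizedVariation_eq hW q (by linarith) (by linarith) N M,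
    tendsto_integral_renormalizedVariation hW q (by omega) hα hα1 hβ hβ1⟩
  obtain ⟨J, hJ⟩ := exists_isMultipleIntegral hW q
  exact ⟨J, hJ, fun J' hJ' => IsMultipleIntegral.unique hW q (by omega) hJ' hJ⟩
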